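/- Let $M$ be a scheme over $\mathbb{C}$, let $P_\bullet$ and $Q_\bullet$ be bounded complexes of vector bundles (locally free $\mathcal{O}_M$-modules of finite rank) on $M$, and let $s\colon P_\bullet\to Q_\bullet$ be a quasi-isomorphism. For a partition $\lambda$ of $n\ge 0$ let $V_\lambda$ be the corresponding irreducible complex representation of the symmetric group $S_n$, and let $$\mathbf{S}_\lambda(P_\bullet)=\left(V_\lambda\otimes P_\bullet^{\otimes n}\right)^{S_n}$$ be the Schur complex, where $P_\bullet^{\otimes n}$ is the $n$-fold tensor power over $\mathcal{O}_M$ of the complex $P_\bullet$, on which $S_n$ acts by permuting the factors with the Koszul signs. Then $\mathbf{S}_\lambda(P_\bullet)$ and $\mathbf{S}_\lambda(Q_\bullet)$ are bounded complexes of vector bundles, and $$[\mathbf{S}_\lambda(P_\bullet)]=[\mathbf{S}_\lambda(Q_\bullet)],\qquad\text{where } [E_\bullet]=\sum_i(-1)^i[E_i],$$ in the Grothendieck group of vector bundles on $M$. If $M$ is locally Noetherian, the same equality holds in the Grothendieck group of coherent sheaves on $M$. -/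

import Mathlib

open CategoryTheory AlgebraicGeometry
open scoped TensorProduct DirectSum

namespace SchurComplex

section Signs

variable {n : ℕ}

/-- The Koszul sign of the permutation `σ` acting on a tensor `x₁ ⊗ ⋯ ⊗ xₙ` of homogeneous elements
of degrees `i 1, …, i n`: each pair of factors whose order is reversed by `σ` contributes
`(-1) ^ (deg x_a * deg x_b)`. -/
def koszulSign (σ : Equiv.Perm (Fin n)) (i : Fin n → ℤ) : ℤˣ :=
  ∏ a, ∏ b, if a < b ∧ σ b < σ a then (i a * i b).negOnePow else 1

/-- The sign `(-1) ^ (i 1 + ⋯ + i (k - 1))` with which the differential reaches the factor `k`. -/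
def prefixSign (i : Fin n → ℤ) (k : Fin n) : ℤˣ :=
  ∏ l, if l < k then (i l).negOnePow else 1

lemma prod_pairs_congr (f g : Fin n → Fin n → ℤˣ) (hd : ∀ a, f a a = g a a)
    (h : ∀ a b, a < b → f a b * f b a = g a b * g b a) :
    ∏ a, ∏ b, f a b = ∏ a, ∏ b, g a b := by
  have key : ∀ F : Fin n → Fin n → ℤˣ, ∏ a, ∏ b, F a b =
      (∏ a, ∏ b, if a < b then F a b * F b a else 1) * ∏ a, F a a := by
    intro F
    have h1 : ∀ a b, F a b = ((if a < b then F a b else 1) * (if b < a then F a b else 1)) *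
        (if a = b then F a b else 1) := by
      intro a b
      rcases lt_trichotomy a b with h | h | h
      · simp [h, h.not_gt, h.ne]
      · simp [h]
      · simp [h, h.not_gt, h.ne']
    conv_lhs => enter [2, a, 2, b]; rw [h1 a b]
    simp only [Finset.prod_mul_distrib, Finset.prod_ite_eq, Finset.mem_univ, if_true]
    congr 1
    rw [Finset.prod_comm (f := fun a b => if b < a then F a b else 1), ← Finset.prod_mul_distrib]
    refine Finset.prod_congr rfl fun a _ => ?_
    rw [← Finset.prod_mul_distrib]
    refine Finset.prod_congr rfl fun b _ => ?_
    split_ifs <;> simp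
  rw [key f, key g]
  congr 1
  · refine Finset.prod_congr rfl fun a _ => Finset.prod_congr rfl fun b _ => ?_
    split_ifs with hab
    · exact h a b hab
    · rfl
  · exact Finset.prod_congr rfl fun a _ => hd a

lemma koszulSign_one (i : Fin n → ℤ) : koszulSign 1 i = 1 := by
  refine Finset.prod_eq_one fun a _ => Finset.prod_eq_one fun b _ => if_neg ?_
  rintro ⟨h, h'⟩
  exact (lt_asymm h h').elim

lemma koszulSign_mul (σ τ : Equiv.Perm (Fin n)) (i : Fin n → ℤ) :
    koszulSign (σ * τ) i = koszulSign σ (fun k => i (τ.symm k)) * koszulSign τ i := by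
  have h : koszulSign σ (fun k => i (τ.symm k)) =
      ∏ a, ∏ b, if τ a < τ b ∧ σ (τ b) < σ (τ a) then (i a * i b).negOnePow else 1 := by
    unfold koszulSign
    rw [← Equiv.prod_comp τ]
    refine Finset.prod_congr rfl fun a _ => ?_
    rw [← Equiv.prod_comp τ]
    simp
  rw [h, koszulSign, koszulSign]
  simp only [← Finset.prod_mul_distrib]
  refine prod_pairs_congr _ _ (by simp) fun a b hab => ?_
  have hba : ¬ b < a := hab.not_gt
  have hs : (i a * i b).negOnePow * (i a * i b).negOnePow = 1 := Int.units_mul_self _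
  have h1 : τ a ≠ τ b := fun h => hab.ne (τ.injective h)
  have h2 : σ (τ a) ≠ σ (τ b) := fun h => h1 (σ.injective h)
  rw [mul_comm (i b) (i a)]
  rcases lt_or_gt_of_ne h1 with h1 | h1 <;> rcases lt_or_gt_of_ne h2 with h2 | h2 <;>
    simp [hab, hba, h1, h1.not_gt, h2, h2.not_gt, hs]

lemma prefixSign_perm (σ : Equiv.Perm (Fin n)) (i : Fin n → ℤ) (k : Fin n) :
    prefixSign (fun l => i (σ.symm l)) (σ k) = ∏ l, if σ l < σ k then (i l).negOnePow else 1 := by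
  unfold prefixSign
  rw [← Equiv.prod_comp σ]
  simp

lemma koszulSign_update (σ : Equiv.Perm (Fin n)) (i : Fin n → ℤ) (k : Fin n) :
    koszulSign σ (Function.update i k (i k + 1)) * prefixSign i k =
      prefixSign (fun l => i (σ.symm l)) (σ k) * koszulSign σ i := by
  have h1 : koszulSign σ (Function.update i k (i k + 1)) = koszulSign σ i *
      ((∏ b, if k < b ∧ σ b < σ k then (i b).negOnePow else 1) *
        ∏ a, if a < k ∧ σ k < σ a then (i a).negOnePow else 1) := by
    have e1 : (∏ b, if k < b ∧ σ b < σ k then (i b).negOnePow else 1) =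
        ∏ a, ∏ b, if a = k then (if a < b ∧ σ b < σ a then (i b).negOnePow else 1) else 1 := by
      rw [Finset.prod_comm]
      simp
    have e2 : (∏ a, if a < k ∧ σ k < σ a then (i a).negOnePow else 1) =
        ∏ a, ∏ b, if b = k then (if a < b ∧ σ b < σ a then (i a).negOnePow else 1) else 1 := by
      simp
    rw [e1, e2]
    unfold koszulSign
    simp only [← Finset.prod_mul_distrib]
    refine Finset.prod_congr rfl fun a _ => Finset.prod_congr rfl fun b _ => ?_
    by_cases hab : a < b ∧ σ b < σ a
    · have hne : a ≠ b := hab.1.ne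
      by_cases ha : a = k
      · have hb : b ≠ k := fun h => hne (ha.trans h.symm)
        subst ha
        simp [hab, hb, add_mul, Int.negOnePow_add]
      · by_cases hb : b = k
        · subst hb
          simp [hab, ha, mul_add, Int.negOnePow_add]
        · simp [hab, ha, hb]
    · simp [hab]
  rw [h1, prefixSign_perm, mul_assoc, mul_comm _ (koszulSign σ i)]
  congr 1
  unfold prefixSign
  simp only [← Finset.prod_mul_distrib]
  refine Finset.prod_congr rfl fun l _ => ?_
  rcases lt_trichotomy l k with h | h | h
  · have h1 : σ l ≠ σ k := fun h' => h.ne (σ.injective h')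
    rcases lt_or_gt_of_ne h1 with h1 | h1 <;> simp [h, h.not_gt, h1, h1.not_gt, Int.units_mul_self]
  · simp [h]
  · have h1 : σ l ≠ σ k := fun h' => h.ne' (σ.injective h')
    rcases lt_or_gt_of_ne h1 with h1 | h1 <;> simp [h, h.not_gt, h1, h1.not_gt]

lemma prefixSign_update (i : Fin n → ℤ) (k l : Fin n) :
    prefixSign (Function.update i k (i k + 1)) l =
      (if k < l then -1 else 1) * prefixSign i l := by
  have : (if k < l then (-1 : ℤˣ) else 1) = ∏ m, if m = k then (if m < l then -1 else 1) else 1 := by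
    simp
  rw [this]
  unfold prefixSign
  rw [← Finset.prod_mul_distrib]
  refine Finset.prod_congr rfl fun m _ => ?_
  by_cases hm : m = k
  · subst hm; by_cases h : m < l <;> simp [h, Int.negOnePow_add]
  · simp [hm]

lemma prefixSign_anticomm (i : Fin n → ℤ) {k l : Fin n} (hkl : k ≠ l) :
    prefixSign (Function.update i k (i k + 1)) l * prefixSign i k =
      - (prefixSign (Function.update i l (i l + 1)) k * prefixSign i l) := by
  rw [prefixSign_update, prefixSign_update]
  rcases lt_or_gt_of_ne hkl with h | h <;> simp [h, h.not_gt, mul_comm]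

end Signs

section TensorPower

variable {R : Type} [CommRing R] (K : CochainComplex (ModuleCat.{0} R) ℤ)

/-- The degree `j` term of the `n`-fold tensor power of a complex `K` of `R`-modules: the direct sum
of the `K^{i 1} ⊗ ⋯ ⊗ K^{i n}` over all `i` with `i 1 + ⋯ + i n = j`. -/
abbrev TensorPower (n : ℕ) (j : ℤ) : Type :=
  ⨁ i : {i : Fin n → ℤ // ∑ k, i k = j}, ⨂[R] k, K.X (i.1 k)

variable {K} {n : ℕ} {j : ℤ}

/-- The tensor `y 1 ⊗ ⋯ ⊗ y n` of homogeneous elements. -/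
noncomputable def homog (y : Fin n → Σ a, K.X a) (h : ∑ k, (y k).1 = j) : TensorPower K n j :=
  DirectSum.lof R _ (fun i : {i : Fin n → ℤ // ∑ k, i k = j} => ⨂[R] k, K.X (i.1 k))
    ⟨fun k => (y k).1, h⟩ (PiTensorProduct.tprod R fun k => (y k).2)

lemma homog_congr {y y' : Fin n → Σ a, K.X a} (e : y = y') (h : ∑ k, (y k).1 = j) :
    homog y h = homog y' (e ▸ h) := by
  subst e; rfl

lemma homog_eq_zero {y : Fin n → Σ a, K.X a} (h : ∑ k, (y k).1 = j) (k : Fin n) {a : ℤ}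
    (hk : y k = ⟨a, 0⟩) : homog y h = 0 := by
  have hk' : ∀ s : Σ a, K.X a, s = ⟨a, 0⟩ → s.2 = 0 := by rintro _ rfl; rfl
  unfold homog
  rw [MultilinearMap.map_coord_zero _ k (hk' _ hk), map_zero]

lemma linearMap_ext {S M : Type} [CommRing S] {φ : R →+* S} [AddCommGroup M] [Module S M]
    {f g : TensorPower K n j →ₛₗ[φ] M}
    (h : ∀ y hy, f (homog y hy) = g (homog y hy)) : f = g := by
  refine LinearMap.ext fun t => ?_
  induction t using DirectSum.induction_on with
  | zero => simp
  | add a b ha hb => rw [map_add, map_add, ha, hb]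
  | of i z =>
    induction z using PiTensorProduct.induction_on with
    | smul_tprod r x =>
      have := h (fun k => ⟨i.1 k, x k⟩) i.2
      have e : DirectSum.of (fun i : {i : Fin n → ℤ // ∑ k, i k = j} => ⨂[R] k, K.X (i.1 k)) i
          (r • PiTensorProduct.tprod R x) = r • homog (fun k => ⟨i.1 k, x k⟩) i.2 :=
        (DirectSum.lof R _ (fun i : {i : Fin n → ℤ // ∑ k, i k = j} => ⨂[R] k, K.X (i.1 k))
          i).map_smul r _
      rw [e, map_smulₛₗ, map_smulₛₗ, this]
    | add a b ha hb => rw [map_add, map_add, map_add, ha, hb]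

lemma sum_perm (σ : Equiv.Perm (Fin n)) {i : Fin n → ℤ} (h : ∑ k, i k = j) :
    ∑ k, i (σ.symm k) = j := by
  rw [Equiv.sum_comp σ.symm i, h]

lemma sum_update {i : Fin n → ℤ} (h : ∑ k, i k = j) (k : Fin n) :
    ∑ l, Function.update i k (i k + 1) l = j + 1 := by
  rw [Finset.sum_update_of_mem (Finset.mem_univ k), ← h,
    ← Finset.add_sum_erase _ _ (Finset.mem_univ k), Finset.sdiff_singleton_eq_erase]
  ring

variable (K j) in
/-- The super action of a permutation on the tensor power:
`σ (x₁ ⊗ ⋯ ⊗ xₙ) = ± x_{σ⁻¹ 1} ⊗ ⋯ ⊗ x_{σ⁻¹ n}`, with the Koszul sign. -/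
noncomputable def permMap (σ : Equiv.Perm (Fin n)) : TensorPower K n j →ₗ[R] TensorPower K n j :=
  DirectSum.toModule R _ _ fun i => (koszulSign σ i.1 : ℤ) •
    (DirectSum.lof R _ (fun i : {i : Fin n → ℤ // ∑ k, i k = j} => ⨂[R] k, K.X (i.1 k))
      ⟨fun k => i.1 (σ.symm k), sum_perm σ i.2⟩ ∘ₗ
        (PiTensorProduct.reindex R (fun k => K.X (i.1 k)) σ).toLinearMap)

lemma permMap_homog (σ : Equiv.Perm (Fin n)) (y : Fin n → Σ a, K.X a) (h : ∑ k, (y k).1 = j) :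
    permMap K j σ (homog y h) = (koszulSign σ (fun k => (y k).1) : ℤ) •
      homog (fun k => y (σ.symm k)) (sum_perm (i := fun k => (y k).1) σ h) := by
  unfold permMap
  conv_lhs => rw [homog, DirectSum.toModule_lof]
  simp only [LinearMap.smul_apply, LinearMap.comp_apply, LinearEquiv.coe_coe,
    PiTensorProduct.reindex_tprod]
  rfl

variable (K n j) in
/-- The super action of the symmetric group on the terms of the tensor power. -/
noncomputable def permRep : Representation R (Equiv.Perm (Fin n)) (TensorPower K n j) where
  toFun := permMap K j
  map_one' := linearMap_ext fun y hy => by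
    rw [permMap_homog, koszulSign_one]
    simp only [Units.val_one, one_smul]
    rfl
  map_mul' σ τ := linearMap_ext fun y hy => by
    rw [Module.End.mul_apply, permMap_homog, permMap_homog, map_zsmul, permMap_homog, smul_smul,
      koszulSign_mul, mul_comm, Units.val_mul]
    rfl

/-- The factor `l` of the map `1 ⊗ ⋯ ⊗ d ⊗ ⋯ ⊗ 1`, with `d` at the place `k`. -/
noncomputable def stepMap (i : Fin n → ℤ) (k l : Fin n) :
    K.X (i l) →ₗ[R] K.X (Function.update i k (i k + 1) l) :=
  if h : l = k then (K.d (i l) (Function.update i k (i k + 1) l)).hom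
  else (K.XIsoOfEq (Function.update_of_ne h (i k + 1) i).symm).hom.hom

variable (K n j) in
/-- The differential of the tensor power:
`d (x₁ ⊗ ⋯ ⊗ xₙ) = ∑ k, (-1) ^ (deg x₁ + ⋯ + deg x_{k-1}) x₁ ⊗ ⋯ ⊗ d x_k ⊗ ⋯ ⊗ xₙ`. -/
noncomputable def diff : TensorPower K n j →ₗ[R] TensorPower K n (j + 1) :=
  DirectSum.toModule R _ _ fun i => ∑ k, (prefixSign i.1 k : ℤ) •
    (DirectSum.lof R _ (fun i : {i : Fin n → ℤ // ∑ k, i k = j + 1} => ⨂[R] k, K.X (i.1 k))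
      ⟨Function.update i.1 k (i.1 k + 1), sum_update i.2 k⟩ ∘ₗ
        PiTensorProduct.map (stepMap i.1 k))

/-- The family `y` with `y k` replaced by its differential. -/
noncomputable def step (y : Fin n → Σ a, K.X a) (k : Fin n) : Fin n → Σ a, K.X a :=
  Function.update y k ⟨(y k).1 + 1, K.d _ _ (y k).2⟩

lemma step_fst (y : Fin n → Σ a, K.X a) (k : Fin n) :
    (fun l => (step y k l).1) = Function.update (fun l => (y l).1) k ((y k).1 + 1) := by
  funext l
  by_cases h : l = k
  · subst h; simp [step]
  · simp [step, h]

lemma sum_step {y : Fin n → Σ a, K.X a} (h : ∑ k, (y k).1 = j) (k : Fin n) :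
    ∑ l, (step y k l).1 = j + 1 := by
  have := sum_update (i := fun l => (y l).1) h k
  rw [← step_fst] at this
  exact this

lemma XIsoOfEq_sigma {a b : ℤ} (e : a = b) (x : K.X a) :
    (⟨b, (K.XIsoOfEq e).hom.hom x⟩ : Σ a, K.X a) = ⟨a, x⟩ := by
  subst e; simp

lemma d_sigma {a b c : ℤ} (e : b = c) (x : K.X a) :
    (⟨b, (K.d a b).hom x⟩ : Σ a, K.X a) = ⟨c, (K.d a c).hom x⟩ := by
  subst e; rfl

lemma diff_homog (y : Fin n → Σ a, K.X a) (h : ∑ k, (y k).1 = j) :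
    diff K n j (homog y h) =
      ∑ k, (prefixSign (fun k => (y k).1) k : ℤ) • homog (step y k) (sum_step h k) := by
  unfold diff
  conv_lhs => rw [homog, DirectSum.toModule_lof]
  simp only [LinearMap.sum_apply, LinearMap.smul_apply, LinearMap.comp_apply,
    PiTensorProduct.map_tprod]
  refine Finset.sum_congr rfl fun k _ => congrArg _ ?_
  refine homog_congr (y := fun l => ⟨Function.update (fun l => (y l).1) k ((y k).1 + 1) l,
    stepMap (fun l => (y l).1) k l (y l).2⟩) ?_ _
  funext l
  by_cases hl : l = k
  · subst hl
    simp only [step, stepMap, dif_pos, Function.update_self]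
    exact d_sigma (by simp) _
  · simp only [step, stepMap, dif_neg hl, Function.update_of_ne hl]
    exact XIsoOfEq_sigma (Function.update_of_ne hl _ (fun l => (y l).1)).symm _

lemma diff_diff : diff K n (j + 1) ∘ₗ diff K n j = 0 := linearMap_ext fun y hy => by
  rw [LinearMap.comp_apply, diff_homog, map_sum, LinearMap.zero_apply]
  simp only [map_zsmul, diff_homog, Finset.smul_sum, smul_smul]
  rw [← Finset.sum_product']
  have hdiag : ∀ k : Fin n, homog (step (step y k) k) (sum_step (sum_step hy k) k) = 0 := by
    intro k
    have h1 : step y k k = ⟨(y k).1 + 1, K.d _ _ (y k).2⟩ := Function.update_self _ _ _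
    have h2 : step (step y k) k k = ⟨(step y k k).1 + 1, K.d _ _ (step y k k).2⟩ :=
      Function.update_self _ _ _
    rw [h1] at h2
    refine homog_eq_zero _ k (h2.trans (congrArg (Sigma.mk _) ?_))
    rw [← ConcreteCategory.comp_apply, K.d_comp_d]
    rfl
  refine Finset.sum_ninvolution Prod.swap ?_ ?_ (by simp) (by simp)
  · rintro ⟨k, l⟩
    by_cases hkl : k = l
    · subst hkl
      simp [hdiag]
    · have hs : step (step y k) l = step (step y l) k := by
        unfold step
        rw [Function.update_of_ne (Ne.symm hkl), Function.update_of_ne hkl,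
          Function.update_comm hkl]
      have e := prefixSign_anticomm (fun m => (y m).1) hkl
      simp only [Prod.swap_prod_mk, step_fst]
      rw [homog_congr hs, ← add_smul]
      have e' := congrArg (Units.val) e
      simp only [Units.val_mul, Units.val_neg] at e'
      rw [mul_comm, e', mul_comm (prefixSign _ _ : ℤ), mul_comm (prefixSign _ _ : ℤ)]
      simp [mul_comm]
  · rintro ⟨k, l⟩ h e
    obtain rfl : l = k := congrArg Prod.fst e
    exact h (by simp [hdiag])

lemma diff_permMap (σ : Equiv.Perm (Fin n)) :
    diff K n j ∘ₗ permMap K j σ = permMap K (j + 1) σ ∘ₗ diff K n j := linearMap_ext fun y hy => by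
  simp only [LinearMap.comp_apply, permMap_homog, diff_homog, map_zsmul, map_sum, Finset.smul_sum,
    smul_smul]
  rw [← Equiv.sum_comp σ]
  refine Finset.sum_congr rfl fun k _ => ?_
  have hs : step (fun l => y (σ.symm l)) (σ k) = fun l => step y k (σ.symm l) := by
    funext l
    by_cases hl : l = σ k
    · subst hl
      unfold step
      rw [Function.update_self, Equiv.symm_apply_apply, Function.update_self]
      exact congrArg (fun s : Σ a, K.X a => (⟨s.1 + 1, K.d _ _ s.2⟩ : Σ a, K.X a))
        (congrArg y (σ.symm_apply_apply k))
    · have : σ.symm l ≠ k := fun h => hl (by rw [← h, Equiv.apply_symm_apply])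
      simp [step, hl, this]
  have e := congrArg Units.val (koszulSign_update σ (fun m => (y m).1) k)
  simp only [Units.val_mul] at e
  rw [← step_fst] at e
  rw [homog_congr hs, mul_comm (koszulSign _ _ : ℤ), ← e, mul_comm]

end TensorPower

section Restriction

variable {R S T : Type} [CommRing R] [CommRing S] [CommRing T]
  {K : CochainComplex (ModuleCat.{0} R) ℤ} {L : CochainComplex (ModuleCat.{0} S) ℤ}
  {Q : CochainComplex (ModuleCat.{0} T) ℤ} {n : ℕ} {j : ℤ}

/-- The map `K^{i 1} ⊗ ⋯ ⊗ K^{i n} → L^{i 1} ⊗ ⋯ ⊗ L^{i n}` induced by maps `K^a → L^a` which are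
semilinear over a ring homomorphism. -/
noncomputable def piMap {φ : R →+* S} (r : ∀ a, K.X a →ₛₗ[φ] L.X a) (i : Fin n → ℤ) :
    (⨂[R] k, K.X (i k)) →ₛₗ[φ] ⨂[S] k, L.X (i k) :=
  letI := Module.compHom (⨂[S] k, L.X (i k)) φ
  let f : MultilinearMap R (fun k => K.X (i k)) (⨂[S] k, L.X (i k)) :=
    { toFun := fun x => PiTensorProduct.tprod S fun k => r (i k) (x k)
      map_update_add' := fun x k a b => by
        classical
        have e : ∀ c, (fun l => r (i l) (Function.update x k c l)) =
            Function.update (fun l => r (i l) (x l)) k (r (i k) c) := fun c => by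
          funext l
          by_cases h : l = k
          · subst h; simp
          · simp [h]
        convert (PiTensorProduct.tprod S).map_update_add (fun l => r (i l) (x l)) k
          (r (i k) a) (r (i k) b) using 2
        · exact (e _).trans (by rw [map_add])
        · exact congrArg _ (e a)
        · exact congrArg _ (e b)
      map_update_smul' := fun x k c a => by
        classical
        have e : ∀ c, (fun l => r (i l) (Function.update x k c l)) =
            Function.update (fun l => r (i l) (x l)) k (r (i k) c) := fun c => by
          funext l
          by_cases h : l = k
          · subst h; simp
          · simp [h]
        convert (PiTensorProduct.tprod S).map_update_smul (fun l => r (i l) (x l)) k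
          (φ c) (r (i k) a) using 2
        · exact (e _).trans (by rw [map_smulₛₗ])
        · exact congrArg (fun z => φ c • PiTensorProduct.tprod S z) (e a) }
  { PiTensorProduct.liftAux f with
    map_smul' := fun c x => (PiTensorProduct.lift f).map_smul c x }

lemma piMap_tprod {φ : R →+* S} (r : ∀ a, K.X a →ₛₗ[φ] L.X a) (i : Fin n → ℤ)
    (x : ∀ k, K.X (i k)) : piMap r i (PiTensorProduct.tprod R x) =
      PiTensorProduct.tprod S fun k => r (i k) (x k) := by
  let _ := Module.compHom (⨂[S] k, L.X (i k)) φ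
  exact PiTensorProduct.liftAux_tprod _ _

variable (n j) in
/-- The map on the terms of tensor powers induced by semilinear maps `K^a → L^a`. -/
noncomputable def tensorPowerMap {φ : R →+* S} (r : ∀ a, K.X a →ₛₗ[φ] L.X a) :
    TensorPower K n j →ₛₗ[φ] TensorPower L n j :=
  let f : TensorPower K n j →+ TensorPower L n j :=
    DirectSum.map fun i : {i : Fin n → ℤ // ∑ k, i k = j} => (piMap r i.1).toAddMonoidHom
  { f with
    map_smul' := fun c x => by
      change f (c • x) = φ c • f x
      ext i
      simp only [f, DirectSum.map_apply, DirectSum.smul_apply]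
      exact (piMap r i.1).map_smulₛₗ c _ }

lemma tensorPowerMap_homog {φ : R →+* S} (r : ∀ a, K.X a →ₛₗ[φ] L.X a)
    (y : Fin n → Σ a, K.X a) (h : ∑ k, (y k).1 = j) :
    tensorPowerMap n j r (homog y h) = homog (fun k => ⟨(y k).1, r _ (y k).2⟩) h := by
  refine (DirectSum.map_of _ _ _).trans ?_
  exact congrArg _ (piMap_tprod r _ _)

lemma tensorPowerMap_permMap {φ : R →+* S} (r : ∀ a, K.X a →ₛₗ[φ] L.X a)
    (σ : Equiv.Perm (Fin n)) (t : TensorPower K n j) :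
    tensorPowerMap n j r (permMap K j σ t) = permMap L j σ (tensorPowerMap n j r t) := by
  refine LinearMap.congr_fun (f := (tensorPowerMap n j r).comp (permMap K j σ))
    (g := (permMap L j σ).comp (tensorPowerMap n j r)) (linearMap_ext fun y hy => ?_) t
  simp only [LinearMap.comp_apply, permMap_homog, map_zsmul, tensorPowerMap_homog]

lemma tensorPowerMap_diff {φ : R →+* S} (r : ∀ a, K.X a →ₛₗ[φ] L.X a)
    (hr : ∀ a b x, r b (K.d a b x) = L.d a b (r a x)) (t : TensorPower K n j) :
    tensorPowerMap n (j + 1) r (diff K n j t) = diff L n j (tensorPowerMap n j r t) := by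
  refine LinearMap.congr_fun (f := (tensorPowerMap n (j + 1) r).comp (diff K n j))
    (g := (diff L n j).comp (tensorPowerMap n j r)) (linearMap_ext fun y hy => ?_) t
  simp only [LinearMap.comp_apply, diff_homog, map_sum, map_zsmul, tensorPowerMap_homog]
  refine Finset.sum_congr rfl fun k _ => congrArg _ (homog_congr ?_ _)
  let g : (Σ a, K.X a) → Σ a, L.X a := fun s => ⟨s.1, r _ s.2⟩
  change (fun l => g (step y k l)) = step (fun l => g (y l)) k
  funext l
  by_cases hl : l = k
  · subst hl
    unfold step
    rw [Function.update_self, Function.update_self]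
    exact congrArg (Sigma.mk _) (hr _ _ _)
  · unfold step
    rw [Function.update_of_ne hl, Function.update_of_ne hl]

lemma tensorPowerMap_id (t : TensorPower K n j) :
    tensorPowerMap n j (fun a => (LinearMap.id : K.X a →ₗ[R] K.X a)) t = t := by
  refine LinearMap.congr_fun (g := LinearMap.id) (linearMap_ext fun y hy => ?_) t
  rw [tensorPowerMap_homog]
  rfl

lemma tensorPowerMap_comp {φ : R →+* S} {ψ : S →+* T} {χ : R →+* T} [RingHomCompTriple φ ψ χ]
    (r : ∀ a, K.X a →ₛₗ[φ] L.X a) (s : ∀ a, L.X a →ₛₗ[ψ] Q.X a) (t : TensorPower K n j) :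
    tensorPowerMap n j (fun a => (s a).comp (r a)) t =
      tensorPowerMap n j s (tensorPowerMap n j r t) := by
  refine LinearMap.congr_fun (f := tensorPowerMap n j (fun a => (s a).comp (r a)))
    (g := (tensorPowerMap n j s).comp (tensorPowerMap n j r)) (linearMap_ext fun y hy => ?_) t
  simp only [LinearMap.comp_apply, tensorPowerMap_homog]

end Restriction

section Schur

variable {n : ℕ} {V : Type} [AddCommGroup V] [Module ℂ V]
  (ρ : Representation ℂ (Equiv.Perm (Fin n)) V)

/-- The extension of scalars `R ⊗_ℂ V` of a complex representation `V`. -/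
noncomputable def baseChangeRep (R : Type) [CommRing R] [Algebra ℂ R] :
    Representation R (Equiv.Perm (Fin n)) (R ⊗[ℂ] V) where
  toFun σ := (ρ σ).baseChange R
  map_one' := by rw [map_one]; exact LinearMap.baseChange_id
  map_mul' σ τ := by rw [map_mul]; exact LinearMap.baseChange_comp _ _

variable {R : Type} [CommRing R] [Algebra ℂ R] (K : CochainComplex (ModuleCat.{0} R) ℤ) (j : ℤ)

/-- The degree `j` term of `V ⊗ K^{⊗ n}`. -/
abbrev TwistedPower (V : Type) [AddCommGroup V] [Module ℂ V]
    (K : CochainComplex (ModuleCat.{0} R) ℤ) (n : ℕ) (j : ℤ) : Type :=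
  (R ⊗[ℂ] V) ⊗[R] TensorPower K n j

/-- The diagonal action of the symmetric group on the terms of `V ⊗ K^{⊗ n}`. -/
noncomputable def twistedRep :
    Representation R (Equiv.Perm (Fin n)) (TwistedPower V K n j) :=
  (baseChangeRep ρ R).tprod (permRep K n j)

/-- The degree `j` term of `(V ⊗ K^{⊗ n})^{S_n}`, for a complex `K` of modules over a commutative
`ℂ`-algebra `R` and a complex representation `V` of the symmetric group `S_n`. -/
noncomputable def schurTerm : Submodule R (TwistedPower V K n j) :=
  { carrier := {x | ∀ σ, twistedRep ρ K j σ x = x}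
    add_mem' := fun hx hy σ => by rw [map_add, hx σ, hy σ]
    zero_mem' := fun σ => map_zero _
    smul_mem' := fun c x hx σ => by rw [map_smul, hx σ] }

noncomputable instance schurTermAddCommGroup : AddCommGroup (schurTerm ρ K j) :=
  Submodule.addCommGroup (M := TwistedPower V K n j) (schurTerm ρ K j)

/-- The differential of `(V ⊗ K^{⊗ n})^{S_n}`. -/
noncomputable def schurDiff : schurTerm ρ K j →ₗ[R] schurTerm ρ K (j + 1) :=
  (TensorProduct.map LinearMap.id (diff K n j)).restrict fun x hx σ => by
    have h : twistedRep ρ K (j + 1) σ ∘ₗ TensorProduct.map LinearMap.id (diff K n j) =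
        TensorProduct.map LinearMap.id (diff K n j) ∘ₗ twistedRep ρ K j σ :=
      TensorProduct.ext' fun v t => congrArg (fun z => _ ⊗ₜ[R] z)
        (LinearMap.congr_fun (diff_permMap σ) t).symm
    exact (LinearMap.congr_fun h x).trans (congrArg _ (hx σ))

lemma schurDiff_schurDiff (x : schurTerm ρ K j) :
    schurDiff ρ K (j + 1) (schurDiff ρ K j x) = 0 := by
  refine Subtype.ext ?_
  change TensorProduct.map LinearMap.id (diff K n (j + 1))
    (TensorProduct.map LinearMap.id (diff K n j) x.1) = 0
  rw [← LinearMap.comp_apply, ← TensorProduct.map_comp, diff_diff, TensorProduct.map_zero_right]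
  rfl

variable {K} {S T : Type} [CommRing S] [Algebra ℂ S] [CommRing T] [Algebra ℂ T]
  {L : CochainComplex (ModuleCat.{0} S) ℤ} {Q : CochainComplex (ModuleCat.{0} T) ℤ}

variable (V) in
/-- The map `R ⊗_ℂ V → S ⊗_ℂ V` induced by a homomorphism of `ℂ`-algebras. -/
noncomputable def scalarMap (φ : R →ₐ[ℂ] S) : R ⊗[ℂ] V →ₛₗ[(φ : R →+* S)] S ⊗[ℂ] V :=
  { TensorProduct.map φ.toLinearMap LinearMap.id with
    map_smul' := fun c x => by
      change TensorProduct.map φ.toLinearMap LinearMap.id (c • x) =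
        φ c • TensorProduct.map φ.toLinearMap LinearMap.id x
      induction x using TensorProduct.induction_on with
      | zero => simp
      | tmul a v => simp [TensorProduct.smul_tmul']
      | add a b ha hb => rw [smul_add, map_add, map_add, ha, hb, smul_add] }

/-- The map on the terms of `(V ⊗ K^{⊗ n})^{S_n}` induced by a homomorphism of `ℂ`-algebras
`R → S` and semilinear maps `K^a → L^a`. -/
noncomputable def schurMap (φ : R →ₐ[ℂ] S) (r : ∀ a, K.X a →ₛₗ[(φ : R →+* S)] L.X a) :
    schurTerm ρ K j →ₛₗ[(φ : R →+* S)] schurTerm ρ L j :=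
  ((TensorProduct.map (scalarMap V φ) (tensorPowerMap n j r)).domRestrict
    (schurTerm ρ K j)).codRestrict _ fun x σ => by
      have h : (twistedRep ρ L j σ).comp (TensorProduct.map (scalarMap V φ) (tensorPowerMap n j r)) =
          (TensorProduct.map (scalarMap V φ) (tensorPowerMap n j r)).comp (twistedRep ρ K j σ) := by
        refine TensorProduct.ext' fun v t => ?_
        change _ ⊗ₜ[S] _ = _ ⊗ₜ[S] _
        congr 1
        · induction v using TensorProduct.induction_on with
          | zero => simp
          | tmul a v => rfl
          | add a b ha hb => simp only [map_add, ha, hb]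
        · exact (tensorPowerMap_permMap r σ t).symm
      exact (LinearMap.congr_fun h x.1).trans (congrArg _ (x.2 σ))

lemma schurMap_diff (φ : R →ₐ[ℂ] S) (r : ∀ a, K.X a →ₛₗ[(φ : R →+* S)] L.X a)
    (hr : ∀ a b x, r b (K.d a b x) = L.d a b (r a x)) (x : schurTerm ρ K j) :
    schurMap ρ (j + 1) φ r (schurDiff ρ K j x) = schurDiff ρ L j (schurMap ρ j φ r x) := by
  refine Subtype.ext ?_
  have h : (TensorProduct.map (scalarMap V φ) (tensorPowerMap n (j + 1) r)).comp
        (TensorProduct.map LinearMap.id (diff K n j)) =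
      (TensorProduct.map LinearMap.id (diff L n j)).comp
        (TensorProduct.map (scalarMap V φ) (tensorPowerMap n j r)) :=
    TensorProduct.ext' fun v t => congrArg (fun z => _ ⊗ₜ[S] z) (tensorPowerMap_diff r hr t)
  exact LinearMap.congr_fun h x.1

lemma schurMap_id (φ : R →ₐ[ℂ] R) (hφ : φ = AlgHom.id ℂ R)
    (r : ∀ a, K.X a →ₛₗ[(φ : R →+* R)] K.X a) (hr : ∀ a x, r a x = x) (x : schurTerm ρ K j) :
    schurMap ρ j φ r x = x := by
  subst hφ
  obtain rfl : r = fun a => (LinearMap.id : K.X a →ₗ[R] K.X a) :=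
    funext fun a => LinearMap.ext (hr a)
  refine Subtype.ext ?_
  have h : TensorProduct.map (scalarMap V (AlgHom.id ℂ R))
      (tensorPowerMap n j (fun a => (LinearMap.id : K.X a →ₗ[R] K.X a))) = LinearMap.id := by
    refine TensorProduct.ext' fun v t => ?_
    exact congrArg₂ (fun a b => a ⊗ₜ[R] b) (LinearMap.congr_fun TensorProduct.map_id v)
      (tensorPowerMap_id t)
  exact LinearMap.congr_fun h x.1

lemma schurMap_comp (φ : R →ₐ[ℂ] S) (ψ : S →ₐ[ℂ] T) (χ : R →ₐ[ℂ] T) (hχ : χ = ψ.comp φ)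
    (r : ∀ a, K.X a →ₛₗ[(φ : R →+* S)] L.X a) (s : ∀ a, L.X a →ₛₗ[(ψ : S →+* T)] Q.X a)
    (t : ∀ a, K.X a →ₛₗ[(χ : R →+* T)] Q.X a)
    (ht : ∀ a x, t a x = s a (r a x)) (x : schurTerm ρ K j) :
    schurMap ρ j χ t x = schurMap ρ j ψ s (schurMap ρ j φ r x) := by
  subst hχ
  have : RingHomCompTriple (φ : R →+* S) (ψ : S →+* T) ((ψ.comp φ : R →ₐ[ℂ] T) : R →+* T) :=
    ⟨rfl⟩
  obtain rfl : t = fun a => (s a).comp (r a) := funext fun a => LinearMap.ext (ht a)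
  refine Subtype.ext ?_
  have h : TensorProduct.map (scalarMap V (ψ.comp φ))
        (tensorPowerMap n j fun a => (s a).comp (r a)) =
      (TensorProduct.map (scalarMap V ψ) (tensorPowerMap n j s)).comp
        (TensorProduct.map (scalarMap V φ) (tensorPowerMap n j r)) := by
    refine TensorProduct.ext' fun v t => ?_
    change _ ⊗ₜ[T] _ = _ ⊗ₜ[T] _
    rw [tensorPowerMap_comp]
    congr 1
    induction v using TensorProduct.induction_on with
    | zero => simp
    | tmul a v => rfl
    | add a b ha hb => simp only [map_add, ha, hb]
  exact LinearMap.congr_fun h x.1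

end Schur

section Young

/-- The box numbered `a` of a Young diagram with `n` boxes: the boxes are numbered consecutively,
row by row, and given as pairs (row, column). -/
noncomputable def box (μ : YoungDiagram) (a : Fin μ.card) : ℕ × ℕ :=
  ofLex ((μ.cells.map toLex.toEmbedding).orderEmbOfFin (Finset.card_map _) a)

open Classical in
/-- The Young symmetrizer `c = a * b` in the group algebra of `S_n`, where `a` is the sum of all
permutations preserving the rows of the diagram, and `b` is the sum of all permutations preserving
its columns, weighted by their signs. -/
noncomputable def youngSymmetrizer (μ : YoungDiagram) :
    MonoidAlgebra ℂ (Equiv.Perm (Fin μ.card)) :=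
  (∑ g with ∀ a, (box μ (g a)).1 = (box μ a).1, MonoidAlgebra.single g 1) *
    ∑ g with ∀ a, (box μ (g a)).2 = (box μ a).2,
      MonoidAlgebra.single g ((Equiv.Perm.sign g : ℤ) : ℂ)

/-- The irreducible representation `V_μ = ℂ[S_n] c` of the symmetric group attached to a
partition `μ` of `n`, with `c` the Young symmetrizer. -/
abbrev Specht (μ : YoungDiagram) : Type := Ideal.span {youngSymmetrizer μ}

/-- The symmetric group acts on `V_μ = ℂ[S_n] c` by multiplication on the left. -/
noncomputable def spechtRep (μ : YoungDiagram) :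
    Representation ℂ (Equiv.Perm (Fin μ.card)) (Specht μ) where
  toFun g := ((Module.toModuleEnd ℂ (S := MonoidAlgebra ℂ (Equiv.Perm (Fin μ.card))) (Specht μ))
    (MonoidAlgebra.single g 1))
  map_one' := map_one _
  map_mul' g h := by rw [← map_mul, MonoidAlgebra.single_mul_single, one_mul]

end Young

section Sheaf

open Opposite

variable {M : Scheme.{0}} [M.Over (Spec (CommRingCat.of ℂ))]

/-- The functions on an open subset of a scheme over `ℂ` form a `ℂ`-algebra. -/
noncomputable instance sectionsAlgebra (U : M.Opens) : Algebra ℂ Γ(M, U) :=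
  ((Scheme.ΓSpecIso (CommRingCat.of ℂ)).inv ≫ (M ↘ Spec (CommRingCat.of ℂ)).appTop ≫
    M.presheaf.map (homOfLE le_top : U ⟶ ⊤).op).hom.toAlgebra

/-- The restriction of functions to a smaller open subset. -/
noncomputable def resAlgHom {U V : M.Opens} (i : U ⟶ V) : Γ(M, V) →ₐ[ℂ] Γ(M, U) :=
  { (M.presheaf.map i.op).hom with
    commutes' := fun c => by
      change (((Scheme.ΓSpecIso (CommRingCat.of ℂ)).inv ≫ (M ↘ Spec (CommRingCat.of ℂ)).appTop ≫
        M.presheaf.map (homOfLE le_top : V ⟶ ⊤).op) ≫ M.presheaf.map i.op).hom c = _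
      rw [Category.assoc, Category.assoc, ← M.presheaf.map_comp]
      rfl }

variable {n : ℕ} {V : Type} [AddCommGroup V] [Module ℂ V]
  (ρ : Representation ℂ (Equiv.Perm (Fin n)) V) (P : CochainComplex M.Modules ℤ)

/-- The sections over `U` of a complex of sheaves of modules. -/
noncomputable def sections (U : M.Opens) : CochainComplex (ModuleCat.{0} Γ(M, U)) ℤ where
  X a := ModuleCat.of Γ(M, U) Γ(P.X a, U)
  d a b := ModuleCat.ofHom
    { toFun := (P.d a b).app U
      map_add' := map_add _
      map_smul' := fun r x => Scheme.Modules.Hom.app_smul _ r x }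
  shape a b h := by
    ext x
    change (P.d a b).app U x = 0
    rw [P.shape a b h]
    rfl
  d_comp_d' a b c _ _ := by
    ext x
    change ((P.d a b) ≫ (P.d b c)).app U x = 0
    rw [P.d_comp_d]
    rfl

/-- The restriction maps of the terms of a complex of sheaves of modules. -/
noncomputable def sectionsRes {U V : M.Opens} (i : U ⟶ V) (a : ℤ) :
    (sections P V).X a →ₛₗ[(resAlgHom i : Γ(M, V) →+* Γ(M, U))] (sections P U).X a where
  toFun := (P.X a).presheaf.map i.op
  map_add' := map_add _
  map_smul' := fun r x => Scheme.Modules.map_smul _ i r x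

lemma sectionsRes_d {U V : M.Opens} (i : U ⟶ V) (a b : ℤ) (x : (sections P V).X a) :
    sectionsRes P i b ((sections P V).d a b x) = (sections P U).d a b (sectionsRes P i a x) :=
  (ConcreteCategory.congr_hom ((P.d a b).mapPresheaf.naturality i.op) x).symm

/-- The presheaf `U ↦ (V ⊗ P(U)^{⊗ n})^{S_n}` in degree `j`, as a presheaf of abelian groups. -/
noncomputable def presheafAb (j : ℤ) : M.Opensᵒᵖ ⥤ Ab.{0} where
  obj U := AddCommGrpCat.of (schurTerm ρ (sections P U.unop) j)
  map i := AddCommGrpCat.ofHom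
    (schurMap ρ j (resAlgHom i.unop) (sectionsRes P i.unop)).toAddMonoidHom
  map_id U := AddCommGrpCat.hom_ext <| AddMonoidHom.ext fun x =>
    schurMap_id ρ j (resAlgHom (𝟙 U).unop)
      (AlgHom.ext fun r => ConcreteCategory.congr_hom (M.presheaf.map_id U) r) _
      (fun a x => ConcreteCategory.congr_hom ((P.X a).presheaf.map_id U) x) x
  map_comp i k := AddCommGrpCat.hom_ext <| AddMonoidHom.ext fun x =>
    schurMap_comp ρ j (resAlgHom i.unop) (resAlgHom k.unop) (resAlgHom (i ≫ k).unop)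
      (AlgHom.ext fun r => ConcreteCategory.congr_hom (M.presheaf.map_comp i k) r)
      (sectionsRes P i.unop) (sectionsRes P k.unop) (sectionsRes P (i ≫ k).unop)
      (fun a x => ConcreteCategory.congr_hom ((P.X a).presheaf.map_comp i k) x) x

/-- The presheaf of modules `U ↦ (V ⊗ P(U)^{⊗ n})^{S_n}` in degree `j`. -/
noncomputable def presheafTerm (j : ℤ) : M.PresheafOfModules :=
  letI : ∀ U, Module (M.ringCatSheaf.obj.obj U) ((presheafAb ρ P j).obj U) := fun U =>
    inferInstanceAs (Module Γ(M, U.unop) (schurTerm ρ (sections P U.unop) j))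
  PresheafOfModules.ofPresheaf (presheafAb ρ P j) fun _ _ i r x =>
    (schurMap ρ j (resAlgHom i.unop) (sectionsRes P i.unop)).map_smulₛₗ r x

/-- The differential of the complex of presheaves of modules `U ↦ (V ⊗ P(U)^{⊗ n})^{S_n}`. -/
noncomputable def presheafDiff (j : ℤ) : presheafTerm ρ P j ⟶ presheafTerm ρ P (j + 1) :=
  PresheafOfModules.homMk
    { app := fun U => AddCommGrpCat.ofHom (schurDiff ρ (sections P U.unop) j).toAddMonoidHom
      naturality := fun _ _ i => AddCommGrpCat.hom_ext <| AddMonoidHom.ext fun x =>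
        (schurMap_diff ρ j (resAlgHom i.unop) (sectionsRes P i.unop)
          (fun a b x => sectionsRes_d P i.unop a b x) x).symm }
    fun U r x => (schurDiff ρ (sections P U.unop) j).map_smul r x

/-- The complex of presheaves of modules `U ↦ (V ⊗ P(U)^{⊗ n})^{S_n}`. -/
noncomputable def presheafComplex : CochainComplex M.PresheafOfModules ℤ :=
  CochainComplex.of (presheafTerm ρ P) (presheafDiff ρ P) fun j => by
    ext U x
    exact schurDiff_schurDiff ρ (sections P U.unop) j x

variable (M) in
/-- The sheafification of presheaves of modules on a scheme. -/
noncomputable def sheafify : M.PresheafOfModules ⥤ M.Modules :=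
  PresheafOfModules.sheafification (𝟙 M.ringCatSheaf.obj)

instance sheafify_isLeftAdjoint : (sheafify M).IsLeftAdjoint :=
  inferInstanceAs (PresheafOfModules.sheafification (𝟙 M.ringCatSheaf.obj)).IsLeftAdjoint

/-- The complex of sheaves of modules `(V ⊗ P^{⊗ n})^{S_n}`. As sheafification commutes with tensor
products, direct sums and invariants, it is obtained by applying the construction to the sections
of `P` over open subsets and sheafifying the result. -/
noncomputable def invariantComplex : CochainComplex M.Modules ℤ :=
  ((sheafify M).mapHomologicalComplex _).obj (presheafComplex ρ P)

/-- The Schur complex `S_μ(P) = (V_μ ⊗ P^{⊗ n})^{S_n}` of a complex `P` of sheaves of modules, where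
`μ` is a partition of `n`. -/
noncomputable def schurComplex (μ : YoungDiagram) (P : CochainComplex M.Modules ℤ) :
    CochainComplex M.Modules ℤ :=
  invariantComplex (spechtRep μ) P

end Sheaf

end SchurComplex

section KGroup

variable {C : Type*} [Category* C] [Abelian C] (A : ObjectProperty C)

/-- The Grothendieck group of a full subcategory of an abelian category: the abelian group generated
by the objects, with a relation `[Y] = [X] + [Z]` for each short exact sequence `0 → X → Y → Z → 0`
with terms in the subcategory. -/
def KGroup : Type _ :=
  FreeAbelianGroup A.FullSubcategory ⧸ AddSubgroup.closure
    {x | ∃ (S : ShortComplex C) (_ : S.ShortExact) (h₁ : A S.X₁) (h₂ : A S.X₂) (h₃ : A S.X₃),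
      x = .of ⟨S.X₂, h₂⟩ - (.of ⟨S.X₁, h₁⟩ + .of ⟨S.X₃, h₃⟩)}

instance : AddCommGroup (KGroup A) :=
  inferInstanceAs (AddCommGroup (FreeAbelianGroup A.FullSubcategory ⧸ _))

variable {A}

/-- The class of an object in the Grothendieck group. -/
def KGroup.mk (X : C) (hX : A X) : KGroup A :=
  QuotientAddGroup.mk (FreeAbelianGroup.of ⟨X, hX⟩)

/-- The complex `K` has only finitely many nonzero terms. -/
def IsBoundedComplex (K : CochainComplex C ℤ) : Prop :=
  ∃ a b : ℤ, ∀ i, i < a ∨ b < i → Limits.IsZero (K.X i)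

/-- The class `∑ (-1) ^ i [K^i]` of a bounded complex with terms in the subcategory. -/
noncomputable def KGroup.ofComplex (K : CochainComplex C ℤ) (hK : ∀ i, A (K.X i)) : KGroup A :=
  ∑ᶠ i : ℤ, (i.negOnePow : ℤ) • KGroup.mk (K.X i) (hK i)

end KGroup

/-- The sheaf of modules `E` is a vector bundle, i.e. locally free of finite rank: each point has an
open neighborhood over which `E` is isomorphic to a finite direct sum of copies of the structure
sheaf. -/
def isVectorBundle (M : Scheme.{0}) : ObjectProperty M.Modules := fun E =>
  ∀ x : M, ∃ (U : M.Opens) (_ : x ∈ U) (r : ℕ),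
    Nonempty (E.restrict U.ι ≅ (SheafOfModules.free (Fin r) : (U : Scheme.{0}).Modules))

/-- The sheaf of modules `E` is quasi-coherent and of finite type. On a locally noetherian scheme,
this means that `E` is coherent. -/
def isCoherent (M : Scheme.{0}) : ObjectProperty M.Modules := fun E =>
  E.IsQuasicoherent ∧ E.IsFiniteType

/-!
The argument works for the invariants `F(P) = (V ⊗ P^{⊗ n})^{S_n}` with any finite-dimensional
representation `V` of `S_n`. Let `s : P → Q` be a quasi-isomorphism.

* The terms of `P ⊕ cone(s)` and `Q ⊕ cone(id_P)` are isomorphic, and `[F(-)]` depends only on the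
  terms of a complex. Since both cones are acyclic, it suffices to show `[F(P)] = [F(P ⊕ C)]` for
  every bounded acyclic complex `C` of vector bundles.
* The cycles of `C` are vector bundles, so over small open sets the sequences of cycles split and
  `C` is contractible. Hence the identity of `P ⊕ C` is homotopic there to the projection onto `P`.
* If `dh + hd = φ - ψ`, then `∑ k, ± ψ^{⊗ (k - 1)} ⊗ h ⊗ φ^{⊗ (n - k)}` is a homotopy between the
  tensor powers of `φ` and `ψ`, since the sum telescopes. It is not equivariant, but averaging over
  `S_n` turns it into a homotopy between the maps on invariants.
* These local homotopies do not glue, but equality of maps on homology sheaves is local. So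
  `F(P) → F(P ⊕ C)` is a quasi-isomorphism of bounded complexes of vector bundles. Its cone is
  acyclic with vector bundles as cycles, so its alternating sum telescopes to zero.
-/
namespace SchurComplex

section TensorHomotopy

variable {R : Type} [CommRing R] {K L : CochainComplex (ModuleCat.{0} R) ℤ} {n : ℕ} {j : ℤ}

lemma sum_fst_update {z : Fin n → Σ a, K.X a} (hz : ∑ l, (z l).1 = j) (k : Fin n)
    (w : K.X (z k).1) : ∑ l, (Function.update z k ⟨(z k).1, w⟩ l).1 = j := by
  rw [← hz]
  refine Finset.sum_congr rfl fun l _ => ?_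
  by_cases hl : l = k
  · subst hl; simp
  · simp [hl]

lemma homog_update_add {z : Fin n → Σ a, K.X a} (hz : ∑ l, (z l).1 = j) (k : Fin n)
    (u v : K.X (z k).1) :
    homog (Function.update z k ⟨(z k).1, u + v⟩) (sum_fst_update hz k _) =
      homog (Function.update z k ⟨(z k).1, u⟩) (sum_fst_update hz k _) +
        homog (Function.update z k ⟨(z k).1, v⟩) (sum_fst_update hz k _) := by
  have update_eq : ∀ w : K.X (z k).1, Function.update z k ⟨(z k).1, w⟩ =
      fun l => ⟨(z l).1, Function.update (fun l => (z l).2) k w l⟩ := fun w => by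
    funext l
    by_cases hl : l = k
    · subst hl; simp
    · simp [hl]
  rw [homog_congr (update_eq _), homog_congr (update_eq _), homog_congr (update_eq _)]
  unfold homog
  rw [MultilinearMap.map_update_add, map_add]

lemma sum_update_sub {i : Fin n → ℤ} (h : ∑ k, i k = j + 1) (k : Fin n) :
    ∑ l, Function.update i k (i k - 1) l = j := by
  have := Finset.add_sum_erase Finset.univ i (Finset.mem_univ k)
  rw [Finset.sum_update_of_mem (Finset.mem_univ k), Finset.sdiff_singleton_eq_erase]
  linarith

lemma prefixSign_update_sub (i : Fin n → ℤ) (k l : Fin n) :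
    prefixSign (Function.update i k (i k - 1)) l =
      (if k < l then -1 else 1) * prefixSign i l := by
  have := prefixSign_update (Function.update i k (i k - 1)) k l
  simp only [Function.update_self, Function.update_idem, sub_add_cancel,
    Function.update_eq_self] at this
  rw [this, ← mul_assoc]
  split_ifs <;> simp

variable {φ ψ : K ⟶ L} (H : Homotopy φ ψ)

lemma homotopy_sigma {a b c : ℤ} (h : b = c) (x : K.X a) :
    (⟨b, H.hom a b x⟩ : Σ a, L.X a) = ⟨c, H.hom a c x⟩ := by
  subst h; rfl

lemma d_homotopy_add_homotopy_d (a : ℤ) (x : K.X a) :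
    L.d (a - 1) a (H.hom a (a - 1) x) + H.hom (a + 1) a (K.d a (a + 1) x) =
      φ.f a x - ψ.f a x := by
  have h : φ.f a = K.d a (a + 1) ≫ H.hom (a + 1) a + H.hom a (a - 1) ≫ L.d (a - 1) a + ψ.f a := by
    rw [H.comm a, dNext_eq _ (show (ComplexShape.up ℤ).Rel a (a + 1) from rfl),
      prevD_eq _ (show (ComplexShape.up ℤ).Rel (a - 1) a from sub_add_cancel a 1)]
  rw [h]
  change _ = H.hom (a + 1) a (K.d a (a + 1) x) + L.d (a - 1) a (H.hom a (a - 1) x) + ψ.f a x -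
    ψ.f a x
  abel

/-- The factor `l` of the map `ψ ⊗ ⋯ ⊗ ψ ⊗ h ⊗ φ ⊗ ⋯ ⊗ φ`, with the homotopy `h` at the
place `k`. -/
noncomputable def lowerMap (i : Fin n → ℤ) (k l : Fin n) :
    K.X (i l) →ₗ[R] L.X (Function.update i k (i k - 1) l) :=
  if hl : l = k then (H.hom _ _).hom
  else (L.XIsoOfEq (Function.update_of_ne hl (i k - 1) i).symm).hom.hom ∘ₗ
    ((if l < k then ψ else φ).f (i l)).hom

variable (n j) in
/-- The homotopy `∑ k, ± ψ ⊗ ⋯ ⊗ ψ ⊗ h ⊗ φ ⊗ ⋯ ⊗ φ`, with `h` at the place `k`, between the maps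
on tensor powers induced by two homotopic maps `φ` and `ψ`. -/
noncomputable def tensorPowerHomotopy : TensorPower K n (j + 1) →ₗ[R] TensorPower L n j :=
  DirectSum.toModule R _ _ fun i => ∑ k, (prefixSign i.1 k : ℤ) •
    (DirectSum.lof R _ (fun i : {i : Fin n → ℤ // ∑ k, i k = j} => ⨂[R] k, L.X (i.1 k))
      ⟨Function.update i.1 k (i.1 k - 1), sum_update_sub i.2 k⟩ ∘ₗ
        PiTensorProduct.map (lowerMap H i.1 k))

variable (φ ψ) in
/-- The family `y` with `ψ` applied to the first `m` entries and `φ` applied to the others. -/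
noncomputable def mixed (y : Fin n → Σ a, K.X a) (m : ℕ) : Fin n → Σ a, L.X a :=
  fun l => ⟨(y l).1, (if l.1 < m then ψ else φ).f _ (y l).2⟩

variable (φ ψ) in
lemma sum_mixed {y : Fin n → Σ a, K.X a} (hy : ∑ k, (y k).1 = j) (m : ℕ) :
    ∑ l, (mixed φ ψ y m l).1 = j := hy

/-- The family `y` with the homotopy applied to the entry `k`, the map `ψ` applied to the preceding
entries and `φ` applied to the following ones. -/
noncomputable def lower (y : Fin n → Σ a, K.X a) (k : Fin n) : Fin n → Σ a, L.X a :=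
  Function.update (mixed φ ψ y k) k ⟨(y k).1 - 1, H.hom _ _ (y k).2⟩

lemma lower_fst (y : Fin n → Σ a, K.X a) (k : Fin n) :
    (fun l => (lower H y k l).1) = Function.update (fun l => (y l).1) k ((y k).1 - 1) := by
  funext l
  by_cases hl : l = k
  · subst hl; simp [lower]
  · simp [lower, hl, mixed]

lemma sum_lower {y : Fin n → Σ a, K.X a} (hy : ∑ k, (y k).1 = j + 1) (k : Fin n) :
    ∑ l, (lower H y k l).1 = j := by
  have := sum_update_sub (i := fun l => (y l).1) hy k
  rwa [← lower_fst H] at this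

lemma tensorPowerHomotopy_homog (y : Fin n → Σ a, K.X a) (hy : ∑ k, (y k).1 = j + 1) :
    tensorPowerHomotopy n j H (homog y hy) =
      ∑ k, (prefixSign (fun k => (y k).1) k : ℤ) • homog (lower H y k) (sum_lower H hy k) := by
  unfold tensorPowerHomotopy
  conv_lhs => rw [homog, DirectSum.toModule_lof]
  simp only [LinearMap.sum_apply, LinearMap.smul_apply, LinearMap.comp_apply,
    PiTensorProduct.map_tprod]
  refine Finset.sum_congr rfl fun k _ => congrArg _ ?_
  refine homog_congr (y := fun l => ⟨Function.update (fun l => (y l).1) k ((y k).1 - 1) l,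
    lowerMap H (fun l => (y l).1) k l (y l).2⟩) ?_ _
  funext l
  by_cases hl : l = k
  · subst hl
    simp only [lower, lowerMap, dif_pos, Function.update_self]
    exact homotopy_sigma H (by simp) _
  · simp only [lower, lowerMap, dif_neg hl, Function.update_of_ne hl, LinearMap.comp_apply]
    exact XIsoOfEq_sigma (Function.update_of_ne hl _ (fun l => (y l).1)).symm _

lemma step_lower (y : Fin n → Σ a, K.X a) {k l : Fin n} (hkl : k ≠ l) :
    step (lower H y k) l = lower H (step y l) k := by
  unfold step lower
  rw [Function.update_of_ne hkl, Function.update_of_ne hkl.symm, Function.update_comm hkl]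
  congr 1
  funext m
  by_cases hm : m = l
  · subst hm
    rw [Function.update_self]
    unfold mixed
    rw [Function.update_self]
    exact congrArg (Sigma.mk _)
      (ConcreteCategory.congr_hom ((if m.1 < k.1 then ψ else φ).comm (y m).1 ((y m).1 + 1)) (y m).2)
  · rw [Function.update_of_ne hm]
    unfold mixed
    rw [Function.update_of_ne hm]

lemma step_lower_self (y : Fin n → Σ a, K.X a) (k : Fin n) :
    step (lower H y k) k = Function.update (mixed φ ψ y k) k
      ⟨(y k).1, L.d ((y k).1 - 1) (y k).1 (H.hom _ _ (y k).2)⟩ := by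
  unfold step lower
  rw [Function.update_self, Function.update_idem]
  exact congrArg _ (d_sigma (by simp) _)

lemma lower_step_self (y : Fin n → Σ a, K.X a) (k : Fin n) :
    lower H (step y k) k = Function.update (mixed φ ψ y k) k
      ⟨(y k).1, H.hom _ _ (K.d (y k).1 ((y k).1 + 1) (y k).2)⟩ := by
  have hk : step y k k = ⟨(y k).1 + 1, K.d _ _ (y k).2⟩ := Function.update_self _ _ _
  unfold lower
  rw [hk]
  funext l
  by_cases hl : l = k
  · subst hl
    rw [Function.update_self, Function.update_self]
    exact homotopy_sigma H (by simp) _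
  · rw [Function.update_of_ne hl, Function.update_of_ne hl]
    unfold mixed step
    rw [Function.update_of_ne hl]

variable (φ ψ) in
lemma mixed_eq_update (y : Fin n → Σ a, K.X a) (k : Fin n) :
    mixed φ ψ y k = Function.update (mixed φ ψ y k) k ⟨(y k).1, φ.f _ (y k).2⟩ := by
  have hk : mixed φ ψ y k k = ⟨(y k).1, φ.f _ (y k).2⟩ := by simp [mixed]
  rw [← hk, Function.update_eq_self]

variable (φ ψ) in
lemma mixed_succ (y : Fin n → Σ a, K.X a) (k : Fin n) :
    mixed φ ψ y (k + 1) = Function.update (mixed φ ψ y k) k ⟨(y k).1, ψ.f _ (y k).2⟩ := by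
  funext l
  by_cases hl : l = k
  · subst hl; simp [mixed]
  · have hlk : l.1 < k.1 + 1 ↔ l.1 < k.1 := by have := Fin.val_ne_of_ne hl; omega
    simp [mixed, hl, hlk]

lemma homog_step_lower_add (y : Fin n → Σ a, K.X a) (hy : ∑ k, (y k).1 = j + 1) (k : Fin n) :
    homog (step (lower H y k) k) (sum_step (sum_lower H hy k) k) +
      homog (lower H (step y k) k) (sum_lower H (sum_step hy k) k) =
    homog (mixed φ ψ y k) (sum_mixed φ ψ hy k) -
      homog (mixed φ ψ y (k + 1)) (sum_mixed φ ψ hy (k + 1)) := by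
  rw [eq_sub_iff_add_eq, homog_congr (step_lower_self H y k), homog_congr (lower_step_self H y k),
    homog_congr (mixed_succ φ ψ y k)]
  refine Eq.trans ?_ (homog_congr (mixed_eq_update φ ψ y k).symm
    (mixed_eq_update φ ψ y k ▸ sum_mixed φ ψ hy k))
  have hadd := fun u v => homog_update_add (sum_mixed φ ψ hy k) k u v
  have hH := eq_sub_iff_add_eq.mp (d_homotopy_add_homotopy_d H _ (y k).2)
  erw [← hadd, ← hadd, hH]
  rfl

/-- Only the two terms in which both `d` and the homotopy act on the factor `k` survive. -/
lemma sum_homog_step_lower (y : Fin n → Σ a, K.X a) (hy : ∑ k, (y k).1 = j + 1) (k : Fin n) :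
    (∑ l, ((prefixSign (fun k => (y k).1) k : ℤ) *
        (prefixSign (fun l => (lower H y k l).1) l : ℤ)) •
          homog (step (lower H y k) l) (sum_step (sum_lower H hy k) l)) +
      (∑ l, ((prefixSign (fun k => (y k).1) l : ℤ) *
        (prefixSign (fun k => (step y l k).1) k : ℤ)) •
          homog (lower H (step y l) k) (sum_lower H (sum_step hy l) k)) =
      homog (mixed φ ψ y k) (sum_mixed φ ψ hy k) -
        homog (mixed φ ψ y (k + 1)) (sum_mixed φ ψ hy (k + 1)) := by
  rw [← Finset.sum_add_distrib, Finset.sum_eq_single k]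
  · rw [← homog_step_lower_add H y hy]
    simp only [lower_fst, step_fst, prefixSign_update_sub, prefixSign_update]
    simp [← Units.val_mul]
  · intro l _ hlk
    rw [homog_congr (step_lower H y hlk.symm), ← add_smul]
    simp only [lower_fst, step_fst, prefixSign_update_sub, prefixSign_update]
    rcases lt_or_gt_of_ne hlk with hl | hl <;> simp [hl, hl.not_gt, mul_comm]
  · simp

lemma diff_tensorPowerHomotopy_add (t : TensorPower K n (j + 1)) :
    diff L n j (tensorPowerHomotopy n j H t) +
        tensorPowerHomotopy n (j + 1) H (diff K n (j + 1) t) =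
      tensorPowerMap n (j + 1) (fun a => (φ.f a).hom) t -
        tensorPowerMap n (j + 1) (fun a => (ψ.f a).hom) t := by
  refine LinearMap.congr_fun (f := diff L n j ∘ₗ tensorPowerHomotopy n j H +
    tensorPowerHomotopy n (j + 1) H ∘ₗ diff K n (j + 1))
    (g := tensorPowerMap n (j + 1) (fun a => (φ.f a).hom) -
      tensorPowerMap n (j + 1) (fun a => (ψ.f a).hom)) (linearMap_ext fun y hy => ?_) t
  simp only [LinearMap.add_apply, LinearMap.comp_apply, LinearMap.sub_apply, diff_homog,
    tensorPowerHomotopy_homog, tensorPowerMap_homog, map_sum, map_zsmul, Finset.smul_sum, smul_smul]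
  rw [Finset.sum_comm (s := Finset.univ) (t := Finset.univ) (f := fun l k =>
    ((prefixSign (fun k => (y k).1) l : ℤ) * (prefixSign (fun k => (step y l k).1) k : ℤ)) •
      homog (lower H (step y l) k) (sum_lower H (sum_step hy l) k)), ← Finset.sum_add_distrib,
    Finset.sum_congr rfl fun k _ => sum_homog_step_lower H y hy k,
    Fin.sum_univ_eq_sum_range (fun m => homog (mixed φ ψ y m) (sum_mixed φ ψ hy m) -
      homog (mixed φ ψ y (m + 1)) (sum_mixed φ ψ hy (m + 1))),
    Finset.sum_range_sub' (fun m => homog (mixed φ ψ y m) (sum_mixed φ ψ hy m))]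
  congr 1
  refine homog_congr (funext fun l => ?_) _
  simp [mixed]

end TensorHomotopy

section SchurHomotopy

variable {n : ℕ} {V : Type} [AddCommGroup V] [Module ℂ V]
  (ρ : Representation ℂ (Equiv.Perm (Fin n)) V) {R : Type} [CommRing R] [Algebra ℂ R]
  {K L N : CochainComplex (ModuleCat.{0} R) ℤ} {j : ℤ}

variable (K j) in
/-- The average of the elements of the symmetric group, acting on `V ⊗ K^{⊗ n}`. -/
noncomputable def average : TwistedPower V K n j →ₗ[R] TwistedPower V K n j :=
  algebraMap ℂ R (n.factorial : ℂ)⁻¹ • ∑ σ, twistedRep ρ K j σ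

lemma average_apply (x : TwistedPower V K n j) :
    average ρ K j x = algebraMap ℂ R (n.factorial : ℂ)⁻¹ • ∑ σ, twistedRep ρ K j σ x := by
  rw [average, LinearMap.smul_apply, LinearMap.sum_apply]

lemma average_mem (x : TwistedPower V K n j) : average ρ K j x ∈ schurTerm ρ K j := by
  intro τ
  rw [average_apply, map_smul, map_sum]
  refine congrArg _ ?_
  rw [← Equiv.sum_comp (Equiv.mulLeft τ) fun σ => twistedRep ρ K j σ x]
  simp only [Equiv.coe_mulLeft, map_mul, Module.End.mul_apply]

lemma average_of_mem {x : TwistedPower V K n j} (hx : x ∈ schurTerm ρ K j) :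
    average ρ K j x = x := by
  have hn : (n.factorial : R) = algebraMap ℂ R n.factorial := by simp
  rw [average_apply, Finset.sum_congr rfl fun σ _ => hx σ, Finset.sum_const, Finset.card_univ,
    Fintype.card_perm, Fintype.card_fin, ← Nat.cast_smul_eq_nsmul R, smul_smul, hn, ← map_mul,
    inv_mul_cancel₀ (by exact_mod_cast n.factorial_ne_zero), map_one, one_smul]

variable (K j) in
/-- The projection of `V ⊗ K^{⊗ n}` onto its invariants, by averaging over the symmetric group. -/
noncomputable def schurProj : TwistedPower V K n j →ₗ[R] schurTerm ρ K j :=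
  (average ρ K j).codRestrict _ (average_mem ρ)

lemma schurProj_coe (x : schurTerm ρ K j) : schurProj ρ K j x = x :=
  Subtype.ext (average_of_mem ρ x.2)

variable (V K j) in
/-- The differential of `V ⊗ K^{⊗ n}`. -/
noncomputable def twistedDiff : TwistedPower V K n j →ₗ[R] TwistedPower V K n (j + 1) :=
  TensorProduct.map LinearMap.id (diff K n j)

lemma coe_schurDiff (x : schurTerm ρ K j) :
    (schurDiff ρ K j x : TwistedPower V K n (j + 1)) = twistedDiff V K j x :=
  rfl

lemma twistedDiff_twistedRep (σ : Equiv.Perm (Fin n)) (x : TwistedPower V K n j) :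
    twistedDiff V K j (twistedRep ρ K j σ x) = twistedRep ρ K (j + 1) σ (twistedDiff V K j x) := by
  have h : twistedRep ρ K (j + 1) σ ∘ₗ twistedDiff V K j =
      twistedDiff V K j ∘ₗ twistedRep ρ K j σ :=
    TensorProduct.ext' fun v t => congrArg (fun z => _ ⊗ₜ[R] z)
      (LinearMap.congr_fun (diff_permMap σ) t).symm
  exact (LinearMap.congr_fun h x).symm

lemma schurDiff_schurProj (x : TwistedPower V K n j) :
    schurDiff ρ K j (schurProj ρ K j x) = schurProj ρ K (j + 1) (twistedDiff V K j x) := by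
  refine Subtype.ext ?_
  change twistedDiff V K j (average ρ K j x) = average ρ K (j + 1) (twistedDiff V K j x)
  simp only [average_apply, map_smul, map_sum, twistedDiff_twistedRep]

variable (j) in
/-- The map `(V ⊗ K^{⊗ n})^{S_n} → (V ⊗ L^{⊗ n})^{S_n}` induced by a morphism of complexes. -/
noncomputable def schurTermMap (φ : K ⟶ L) : schurTerm ρ K j →ₗ[R] schurTerm ρ L j :=
  schurMap ρ j (AlgHom.id ℂ R) fun a => (φ.f a).hom

lemma coe_schurTermMap (φ : K ⟶ L) (x : schurTerm ρ K j) :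
    (schurTermMap ρ j φ x : TwistedPower V L n j) =
      TensorProduct.map LinearMap.id (tensorPowerMap n j fun a => (φ.f a).hom) x.1 := by
  have h : TensorProduct.map (scalarMap V (AlgHom.id ℂ R))
        (tensorPowerMap n j fun a => (φ.f a).hom) =
      TensorProduct.map (LinearMap.id : R ⊗[ℂ] V →ₗ[R] R ⊗[ℂ] V)
        (tensorPowerMap n j fun a => (φ.f a).hom) :=
    TensorProduct.ext' fun v t => congrArg (fun w => w ⊗ₜ[R] _)
      (LinearMap.congr_fun TensorProduct.map_id v)
  exact LinearMap.congr_fun h x.1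

lemma schurTermMap_schurDiff (φ : K ⟶ L) (x : schurTerm ρ K j) :
    schurTermMap ρ (j + 1) φ (schurDiff ρ K j x) = schurDiff ρ L j (schurTermMap ρ j φ x) :=
  schurMap_diff ρ j _ _
    (fun a b x => (ConcreteCategory.congr_hom (φ.comm a b) x).symm) x

variable {φ ψ : K ⟶ L} (H : Homotopy φ ψ)

variable (j) in
/-- The homotopy on `(V ⊗ K^{⊗ n})^{S_n}` obtained by averaging the one on `V ⊗ K^{⊗ n}`. -/
noncomputable def schurHomotopy : schurTerm ρ K (j + 1) →ₗ[R] schurTerm ρ L j :=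
  schurProj ρ L j ∘ₗ TensorProduct.map LinearMap.id (tensorPowerHomotopy n j H) ∘ₗ
    (schurTerm ρ K (j + 1)).subtype

lemma schurDiff_schurHomotopy_add (x : schurTerm ρ K (j + 1)) :
    schurDiff ρ L j (schurHomotopy ρ j H x) + schurHomotopy ρ (j + 1) H (schurDiff ρ K (j + 1) x) +
        schurTermMap ρ (j + 1) ψ x =
      schurTermMap ρ (j + 1) φ x := by
  have h : twistedDiff V L j ∘ₗ TensorProduct.map LinearMap.id (tensorPowerHomotopy n j H) +
        TensorProduct.map LinearMap.id (tensorPowerHomotopy n (j + 1) H) ∘ₗ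
          twistedDiff V K (j + 1) +
        TensorProduct.map LinearMap.id (tensorPowerMap n (j + 1) fun a => (ψ.f a).hom) =
      TensorProduct.map (LinearMap.id : R ⊗[ℂ] V →ₗ[R] R ⊗[ℂ] V)
        (tensorPowerMap n (j + 1) fun a => (φ.f a).hom) :=
    TensorProduct.ext' fun v t => by
      simp only [twistedDiff, LinearMap.add_apply, LinearMap.comp_apply, TensorProduct.map_tmul,
        LinearMap.id_apply, ← TensorProduct.tmul_add, diff_tensorPowerHomotopy_add, sub_add_cancel]
  rw [← schurProj_coe ρ (schurTermMap ρ (j + 1) φ x), ← schurProj_coe ρ (schurTermMap ρ _ ψ x)]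
  simp only [schurHomotopy, LinearMap.comp_apply, Submodule.subtype_apply, schurDiff_schurProj,
    coe_schurDiff, coe_schurTermMap]
  rw [← map_add, ← map_add]
  exact congrArg _ (LinearMap.congr_fun h x.1)

lemma schurDiff_schurHomotopy_add_of_schurDiff_eq_zero {x : schurTerm ρ K (j + 1)}
    (hx : schurDiff ρ K (j + 1) x = 0) :
    schurDiff ρ L j (schurHomotopy ρ j H x) + schurTermMap ρ (j + 1) ψ x =
      schurTermMap ρ (j + 1) φ x := by
  have h := schurDiff_schurHomotopy_add ρ H x
  rwa [hx, map_zero, add_zero] at h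

end SchurHomotopy

lemma exists_det_ne_zero_of_span_eq_top {k ι κ : Type*} [Field k] [Fintype ι] [DecidableEq ι]
    (v : κ → ι → k) (hv : Submodule.span k (Set.range v) = ⊤) :
    ∃ a : ι → κ, (Matrix.of fun l m => v (a m) l).det ≠ 0 := by
  obtain ⟨κ', a, -, hs, hli⟩ := exists_linearIndependent' k v
  let b := Module.Basis.mk hli (hs.trans hv).ge
  let e := (Pi.basisFun k ι).indexEquiv b
  refine ⟨a ∘ e, ?_⟩
  rw [← isUnit_iff_ne_zero, ← Matrix.isUnit_iff_isUnit_det,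
    ← Matrix.linearIndependent_cols_iff_isUnit]
  exact hli.comp e e.injective

section Sections

variable {M : Scheme.{0}} {U V W : M.Opens} {F G H : M.PresheafOfModules}

/-- The restriction of functions to a smaller open subset. -/
noncomputable def resFun (h : V ≤ U) : Γ(M, U) →+* Γ(M, V) :=
  (M.presheaf.map (homOfLE h).op).hom

lemma resFun_resFun (h : V ≤ U) (h' : W ≤ V) (a : Γ(M, U)) :
    resFun h' (resFun h a) = resFun (h'.trans h) a :=
  (ConcreteCategory.congr_hom (M.presheaf.map_comp (homOfLE h).op (homOfLE h').op) a).symm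

/-- The sections over `U` of a presheaf of modules, as a module over the ring `Γ(M, U)`; for a sheaf
of modules `E`, use `Sect E.val U`. -/
def Sect (G : M.PresheafOfModules) (U : M.Opens) : Type := G.obj (.op U)

noncomputable instance : AddCommGroup (Sect G U) := inferInstanceAs (AddCommGroup (G.obj (.op U)))

noncomputable instance : Module Γ(M, U) (Sect G U) := (G.obj (.op U)).isModule

namespace Sect

/-- The restriction of sections to a smaller open subset. -/
noncomputable def res (h : V ≤ U) : Sect G U →ₛₗ[resFun h] Sect G V where
  toFun x := G.presheaf.map (homOfLE h).op x
  map_add' x y := map_add _ x y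
  map_smul' a x := G.map_smul (homOfLE h).op a x

lemma res_res (h : V ≤ U) (h' : W ≤ V) (x : Sect G U) : res h' (res h x) = res (h'.trans h) x :=
  (G.map_comp_apply (homOfLE h).op (homOfLE h').op x).symm

/-- The action of a morphism of presheaves of modules on sections. -/
noncomputable def map (f : F ⟶ G) (U : M.Opens) : Sect F U →ₗ[Γ(M, U)] Sect G U :=
  (f.app (.op U)).hom

lemma map_res (f : F ⟶ G) (h : V ≤ U) (x : Sect F U) :
    map f V (res h x) = res h (map f U x) :=
  PresheafOfModules.naturality_apply f (homOfLE h).op x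

end Sect

/-- A morphism from the restriction of `F` to `U` to the restriction of `G` to `U`. -/
structure HomOver (U : M.Opens) (F G : M.PresheafOfModules) where
  app : ∀ V ≤ U, Sect F V →ₗ[Γ(M, V)] Sect G V
  app_res : ∀ {V W : M.Opens} (h : V ≤ U) (h' : W ≤ V) (x : Sect F V),
    app W (h'.trans h) (Sect.res h' x) = Sect.res h' (app V h x)

namespace HomOver

/-- The restriction of a morphism to a smaller open subset. -/
def res (f : HomOver U F G) (h : V ≤ U) : HomOver V F G where
  app W hW := f.app W (hW.trans h)
  app_res hW := f.app_res (hW.trans h)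

lemma res_app (f : HomOver U F G) (h : V ≤ U) (hW : W ≤ V) :
    (f.res h).app W hW = f.app W (hW.trans h) := rfl

end HomOver

/-- The sections `e` over `U` restrict to a basis of the module of sections over each open subset
of `U`, that is, they trivialize `G` over `U`. -/
def IsFrame {ι : Type*} (e : ι → Sect G U) : Prop :=
  ∀ (V : M.Opens) (h : V ≤ U), LinearIndependent Γ(M, V) (fun k => Sect.res h (e k)) ∧
    Submodule.span Γ(M, V) (Set.range fun k => Sect.res h (e k)) = ⊤

namespace IsFrame

variable {ι κ : Type*} {e : ι → Sect G U}

lemma of_basis (b : ∀ V ≤ U, Module.Basis ι Γ(M, V) (Sect G V))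
    (hb : ∀ V h k, b V h k = Sect.res h (e k)) : IsFrame e := by
  intro V h
  rw [← funext (hb V h)]
  exact ⟨(b V h).linearIndependent, (b V h).span_eq⟩

lemma of_subsingleton [IsEmpty ι] (h : ∀ V ≤ U, Subsingleton (Sect G V)) : IsFrame e :=
  fun V hV =>
    have := h V hV
    ⟨linearIndependent_empty_type, Subsingleton.elim _ _⟩

lemma res (he : IsFrame e) (h : V ≤ U) : IsFrame fun k => Sect.res h (e k) := by
  intro W hW
  simp only [Sect.res_res]
  exact he W (hW.trans h)

lemma reindex (he : IsFrame e) (f : κ ≃ ι) : IsFrame (e ∘ f) := fun V h =>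
  ⟨(he V h).1.comp f f.injective,
    (congrArg _ (f.surjective.range_comp fun k => Sect.res h (e k))).trans (he V h).2⟩

/-- The basis of the module of sections over an open subset given by a frame. -/
noncomputable def basis (he : IsFrame e) (h : V ≤ U) : Module.Basis ι Γ(M, V) (Sect G V) :=
  Module.Basis.mk (he V h).1 (he V h).2.ge

lemma basis_apply (he : IsFrame e) (h : V ≤ U) (k : ι) : he.basis h k = Sect.res h (e k) :=
  Module.Basis.mk_apply _ _ k

lemma basis_repr_res (he : IsFrame e) (h : V ≤ U) (h' : W ≤ V) (x : Sect G V) (k : ι) :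
    (he.basis (h'.trans h)).repr (Sect.res h' x) k = resFun h' ((he.basis h).repr x k) := by
  induction (he.basis h).mem_span x using Submodule.span_induction with
  | mem y hy =>
    obtain ⟨l, rfl⟩ := hy
    rw [Module.Basis.repr_self, he.basis_apply, Sect.res_res, ← he.basis_apply,
      Module.Basis.repr_self]
    classical simp [Finsupp.single_apply, apply_ite (resFun h')]
  | zero => simp
  | add y z _ _ hy hz => simp [hy, hz]
  | smul a y _ hy => simp [map_smulₛₗ, hy]

lemma basis_det_res [Fintype ι] [DecidableEq ι] (he : IsFrame e) (h : V ≤ U) (h' : W ≤ V)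
    (v : ι → Sect G V) : (he.basis (h'.trans h)).det (fun k => Sect.res h' (v k)) =
      resFun h' ((he.basis h).det v) := by
  rw [Module.Basis.det_apply, Module.Basis.det_apply, RingHom.map_det]
  congr 1
  ext k l
  exact he.basis_repr_res h h' (v l) k

/-- The values at `x` of finitely many spanning sections span the fibre, so some of them form a
basis of the fibre, and they remain a basis where their determinant does not vanish. -/
lemma exists_isFrame_of_span_eq_top [Finite ι] (he : IsFrame e) {f : κ → Sect G U}
    (hf : Submodule.span Γ(M, U) (Set.range f) = ⊤) {x : M} (hx : x ∈ U) :
    ∃ (W : M.Opens) (hW : W ≤ U) (a : ι → κ), x ∈ W ∧ IsFrame fun m => Sect.res hW (f (a m)) := by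
  classical
  have := Fintype.ofFinite ι
  let b := he.basis le_rfl
  let ev := (M.evaluation U x hx).hom
  let val : Sect G U →ₛₗ[ev] ι → M.residueField x :=
    { toFun y l := ev (b.repr y l)
      map_add' y z := by ext; simp
      map_smul' c y := by ext; simp }
  have hspan : Submodule.span (M.residueField x) (Set.range (val ∘ f)) = ⊤ := by
    have hle : (⊤ : Submodule Γ(M, U) (Sect G U)) ≤
        (Submodule.span (M.residueField x) (Set.range (val ∘ f))).comap val := by
      rw [← hf, Submodule.span_le]
      rintro _ ⟨k, rfl⟩
      exact Submodule.subset_span ⟨k, rfl⟩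
    rw [eq_top_iff, ← (Pi.basisFun _ ι).span_eq, Submodule.span_le]
    rintro _ ⟨k, rfl⟩
    have hk : Pi.basisFun (M.residueField x) ι k = val (b k) := by
      ext l
      simp [val, Finsupp.single_apply, Pi.single_apply, eq_comm, apply_ite ev]
    exact hk ▸ hle (Submodule.mem_top : b k ∈ ⊤)
  obtain ⟨a, ha⟩ := exists_det_ne_zero_of_span_eq_top _ hspan
  let d := b.det (f ∘ a)
  have hd : ev d ≠ 0 := by
    rwa [show d = _ from b.det_apply _, RingHom.map_det]
  have hdU : M.basicOpen d ≤ U := M.basicOpen_le d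
  refine ⟨M.basicOpen d, hdU, a, (Scheme.evaluation_ne_zero_iff_mem_basicOpen M x hx _).mp hd,
    fun V h => (Module.Basis.is_basis_iff_det (he.basis (h.trans hdU))).mpr ?_⟩
  simp only [Sect.res_res]
  rw [he.basis_det_res le_rfl, ← resFun_resFun hdU h]
  exact (RingedSpace.isUnit_res_basicOpen _ d).map (resFun h)

lemma of_retract (he : IsFrame e) (i : HomOver U F G) (r : HomOver U G F)
    (hri : ∀ V h x, r.app V h (i.app V h x) = x) (p : ι → Prop)
    (hp : ∀ k, p k → i.app U le_rfl (r.app U le_rfl (e k)) = e k)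
    (hn : ∀ k, ¬ p k → r.app U le_rfl (e k) = 0) :
    IsFrame fun k : {k // p k} => r.app U le_rfl (e k) := by
  intro V h
  refine ⟨LinearIndependent.of_comp (i.app V h) ?_, ?_⟩
  · convert (he V h).1.comp _ Subtype.val_injective using 1
    funext k
    exact (i.app_res le_rfl h _).trans (by rw [hp k k.2]; rfl)
  · rw [eq_top_iff]
    rintro y -
    have hle : Submodule.span Γ(M, V) (Set.range fun k => Sect.res h (e k)) ≤
        (Submodule.span Γ(M, V) (Set.range fun k : {k // p k} =>
          Sect.res h (r.app U le_rfl (e k)))).comap (r.app V h) := by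
      rw [Submodule.span_le]
      rintro _ ⟨k, rfl⟩
      rw [SetLike.mem_coe, Submodule.mem_comap, r.app_res le_rfl h]
      by_cases hk : p k
      · exact Submodule.subset_span ⟨⟨k, hk⟩, rfl⟩
      · simp [hn k hk]
    simpa [hri] using hle ((he V h).2.ge (Submodule.mem_top : i.app V h y ∈ ⊤))

/-- With `q = i ∘ r`, the sections `q eₖ` and `eₖ - q eₖ` span, so a frame can locally be chosen
among them. -/
lemma exists_isFrame_of_retract [Finite ι] (he : IsFrame e) (i : HomOver U F G)
    (r : HomOver U G F) (hri : ∀ V h x, r.app V h (i.app V h x) = x) {x : M} (hx : x ∈ U) :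
    ∃ W ≤ U, x ∈ W ∧ ∃ (n : ℕ) (g : Fin n → Sect F W), IsFrame g := by
  classical
  let b := he.basis le_rfl
  let q (y : Sect G U) := i.app U le_rfl (r.app U le_rfl y)
  let f : ι ⊕ ι → Sect G U := Sum.elim (fun k => q (b k)) fun k => b k - q (b k)
  have hf : Submodule.span Γ(M, U) (Set.range f) = ⊤ := by
    rw [eq_top_iff, ← b.span_eq, Submodule.span_le]
    rintro _ ⟨k, rfl⟩
    rw [← sub_add_cancel (b k) (q (b k))]
    exact add_mem (Submodule.subset_span ⟨.inr k, rfl⟩) (Submodule.subset_span ⟨.inl k, rfl⟩)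
  have hleft (s : ι ⊕ ι) (hs : s.isLeft) : q (f s) = f s := by
    obtain ⟨k, rfl⟩ := Sum.isLeft_iff.mp hs
    simp only [f, q, Sum.elim_inl, hri]
  have hright (s : ι ⊕ ι) (hs : ¬ s.isLeft) : r.app U le_rfl (f s) = 0 := by
    rcases s with k | k
    · exact (hs rfl).elim
    · simp [f, q, hri]
  obtain ⟨W, hW, a, hxW, hfr⟩ := he.exists_isFrame_of_span_eq_top hf hx
  have hg := hfr.of_retract (i.res hW) (r.res hW) (fun V h => hri V (h.trans hW))
    (fun m => (a m).isLeft)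
    (fun m hm => by
      rw [HomOver.res_app, HomOver.res_app, r.app_res le_rfl hW, i.app_res le_rfl hW]
      exact congrArg _ (hleft _ hm))
    (fun m hm => by rw [HomOver.res_app, r.app_res le_rfl hW, hright _ hm, map_zero])
  exact ⟨W, hW, hxW, _, _, hg.reindex (Finite.equivFin _).symm⟩

end IsFrame

variable (G) in
/-- Each point has an open neighbourhood over which `G` has a finite frame. -/
def IsLocallyFree : Prop :=
  ∀ x : M, ∃ U : M.Opens, x ∈ U ∧ ∃ (r : ℕ) (e : Fin r → Sect G U), IsFrame e

end Sections

section Sheafification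

variable {M : Scheme.{0}} {U V W : M.Opens} {F G : M.PresheafOfModules} {E : M.Modules}

lemma resFun_eq_of_locally_eq {a b : Γ(M, V)}
    (h : ∀ p ∈ V, ∃ (W : M.Opens) (hW : W ≤ V), p ∈ W ∧ resFun hW a = resFun hW b) : a = b := by
  choose W hW hp he using h
  refine TopCat.Sheaf.eq_of_locally_eq' M.sheaf (fun p : V => W p.1 p.2) V
    (fun p => homOfLE (hW p.1 p.2)) (fun p hp' => ?_) a b fun p => he p.1 p.2
  exact TopologicalSpace.Opens.mem_iSup.mpr ⟨⟨p, hp'⟩, hp p hp'⟩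

lemma exists_resFun_eq {W : V → M.Opens} (hW : ∀ p, W p ≤ V) (hp : ∀ p : V, p.1 ∈ W p)
    (a : ∀ p, Γ(M, W p))
    (ha : ∀ p q W' (h : W' ≤ W p) (h' : W' ≤ W q), resFun h (a p) = resFun h' (a q)) :
    ∃ b, ∀ p, resFun (hW p) b = a p := by
  obtain ⟨b, hb, -⟩ := TopCat.Sheaf.existsUnique_gluing' M.sheaf W V (fun p => homOfLE (hW p))
    (fun p hp' => TopologicalSpace.Opens.mem_iSup.mpr ⟨⟨p, hp'⟩, hp ⟨p, hp'⟩⟩) a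
    (fun p q => ha p q (W p ⊓ W q) inf_le_left inf_le_right)
  exact ⟨b, hb⟩

namespace Sect

lemma eq_of_locally_eq {x y : Sect E.val V}
    (h : ∀ p ∈ V, ∃ (W : M.Opens) (hW : W ≤ V), p ∈ W ∧ res hW x = res hW y) : x = y := by
  choose W hW hp he using h
  refine TopCat.Sheaf.eq_of_locally_eq' (⟨E.presheaf, E.isSheaf⟩ : TopCat.Sheaf Ab M)
    (fun p : V => W p.1 p.2) V
    (fun p => homOfLE (hW p.1 p.2)) (fun p hp' => ?_) x y fun p => he p.1 p.2
  exact TopologicalSpace.Opens.mem_iSup.mpr ⟨⟨p, hp'⟩, hp p hp'⟩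

lemma exists_res_eq_zero (η : F ⟶ G)
    [PresheafOfModules.IsLocallyInjective (Opens.grothendieckTopology M) η] {x : Sect F V}
    (hx : map η V x = 0) {p : M} (hp : p ∈ V) :
    ∃ (W : M.Opens) (hW : W ≤ V), p ∈ W ∧ res hW x = 0 := by
  obtain ⟨W, i, hi, hpW⟩ := Presheaf.equalizerSieve_mem (Opens.grothendieckTopology M)
    ((PresheafOfModules.toPresheaf _).map η) x 0 (hx.trans (map_zero _).symm) p hp
  exact ⟨W, leOfHom i, hpW, hi.trans (map_zero _)⟩

lemma exists_map_eq_res (η : F ⟶ G)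
    [PresheafOfModules.IsLocallySurjective (Opens.grothendieckTopology M) η] (y : Sect G V)
    {p : M} (hp : p ∈ V) :
    ∃ (W : M.Opens) (hW : W ≤ V), p ∈ W ∧ ∃ x, map η W x = res hW y := by
  obtain ⟨W, i, ⟨x, hx⟩, hpW⟩ := Presheaf.imageSieve_mem (Opens.grothendieckTopology M)
    ((PresheafOfModules.toPresheaf _).map η) y p hp
  exact ⟨W, leOfHom i, hpW, x, hx⟩

end Sect

namespace IsFrame

variable {ι : Type*} {e : ι → Sect F U}

lemma map_injective (he : IsFrame e) (η : F ⟶ G)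
    [PresheafOfModules.IsLocallyInjective (Opens.grothendieckTopology M) η] (h : V ≤ U) :
    Function.Injective (Sect.map η V) := by
  rw [injective_iff_map_eq_zero]
  intro x hx
  refine (he.basis h).ext_elem fun k => resFun_eq_of_locally_eq fun p hp => ?_
  obtain ⟨W, hW, hpW, hxW⟩ := Sect.exists_res_eq_zero η hx hp
  exact ⟨W, hW, hpW, by simp [← he.basis_repr_res h hW, hxW]⟩

lemma map_surjective [Finite ι] (he : IsFrame e) (η : F ⟶ E.val)
    [PresheafOfModules.IsLocallyInjective (Opens.grothendieckTopology M) η]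
    [PresheafOfModules.IsLocallySurjective (Opens.grothendieckTopology M) η] (h : V ≤ U) :
    Function.Surjective (Sect.map η V) := by
  have := Fintype.ofFinite ι
  intro y
  choose W hW hp x hx using fun p : V => Sect.exists_map_eq_res η y p.2
  have hglue (p q : V) (W' : M.Opens) (hp' : W' ≤ W p) (hq' : W' ≤ W q) :
      Sect.res hp' (x p) = Sect.res hq' (x q) := by
    apply he.map_injective η ((hp'.trans (hW p)).trans h)
    rw [Sect.map_res, Sect.map_res, hx, hx, Sect.res_res, Sect.res_res]
  have hcoeff (k : ι) : ∃ c, ∀ p, resFun (hW p) c = (he.basis ((hW p).trans h)).repr (x p) k :=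
    exists_resFun_eq hW hp _ fun p q W' hp' hq' => by
      rw [← he.basis_repr_res, ← he.basis_repr_res, hglue p q W' hp' hq']
  choose c hc using hcoeff
  refine ⟨∑ k, c k • he.basis h k, Sect.eq_of_locally_eq fun p hpV =>
    ⟨W ⟨p, hpV⟩, hW _, hp ⟨p, hpV⟩, ?_⟩⟩
  rw [← hx ⟨p, hpV⟩, ← Sect.map_res, ← (he.basis ((hW ⟨p, hpV⟩).trans h)).sum_repr (x ⟨p, hpV⟩)]
  simp only [map_sum, map_smulₛₗ, hc, he.basis_apply, Sect.res_res]

lemma map [Finite ι] (he : IsFrame e) (η : F ⟶ E.val)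
    [PresheafOfModules.IsLocallyInjective (Opens.grothendieckTopology M) η]
    [PresheafOfModules.IsLocallySurjective (Opens.grothendieckTopology M) η] :
    IsFrame fun k => Sect.map η U (e k) :=
  of_basis (fun V h => (he.basis h).map
    (.ofBijective (Sect.map η V) ⟨he.map_injective η h, he.map_surjective η h⟩))
    fun V h k => (congrArg (Sect.map η V) (he.basis_apply h k)).trans (Sect.map_res η h (e k))

end IsFrame

/-- The unit of the sheafification of presheaves of modules. -/
noncomputable def toSheafify (G : M.PresheafOfModules) : G ⟶ ((sheafify M).obj G).val :=
  PresheafOfModules.sheafificationHomEquiv (𝟙 M.ringCatSheaf.obj) (𝟙 _)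

instance (G : M.PresheafOfModules) :
    PresheafOfModules.IsLocallyInjective (Opens.grothendieckTopology M) (toSheafify G) :=
  inferInstanceAs (Presheaf.IsLocallyInjective (Opens.grothendieckTopology M)
    (CategoryTheory.toSheafify (Opens.grothendieckTopology M) G.presheaf))

instance (G : M.PresheafOfModules) :
    PresheafOfModules.IsLocallySurjective (Opens.grothendieckTopology M) (toSheafify G) :=
  inferInstanceAs (Presheaf.IsLocallySurjective (Opens.grothendieckTopology M)
    (CategoryTheory.toSheafify (Opens.grothendieckTopology M) G.presheaf))

lemma IsLocallyFree.sheafify (hG : IsLocallyFree G) : IsLocallyFree ((sheafify M).obj G).val := by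
  intro x
  obtain ⟨U, hx, r, e, he⟩ := hG x
  exact ⟨U, hx, r, _, he.map (toSheafify G)⟩

end Sheafification

section TwistedBasis

variable {n : ℕ} {V : Type} [AddCommGroup V] [Module ℂ V]
  {R S T : Type} [CommRing R] [CommRing S] [CommRing T]
  {K : CochainComplex (ModuleCat.{0} R) ℤ} {L : CochainComplex (ModuleCat.{0} S) ℤ}
  {Q : CochainComplex (ModuleCat.{0} T) ℤ} (j : ℤ)
  {ι : ℤ → Type} (b : ∀ a, Module.Basis (ι a) R (K.X a))
  {κ : Type} (c : Module.Basis κ ℂ V)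

variable (n ι) in
/-- The index set of the basis of the degree `j` part of an `n`-fold tensor power obtained from
bases of the terms of the complex indexed by `ι`. -/
abbrev PowerIndex : Type := Σ i : {i : Fin n → ℤ // ∑ k, i k = j}, ∀ k, ι (i.1 k)

variable {j} in
lemma finite_powerIndex [Finite (Σ a, ι a)] : Finite (PowerIndex n j ι) := by
  refine Finite.of_injective (β := Fin n → Σ a, ι a) (fun s k => ⟨s.1.1 k, s.2 k⟩) ?_
  rintro ⟨⟨i, hi⟩, k⟩ ⟨⟨i', hi'⟩, k'⟩ h
  obtain rfl : i = i' := funext fun l => congrArg Sigma.fst (congrFun h l)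
  congr 1
  funext l
  simpa using congrFun h l

/-- The basis of a term of a tensor power of a complex with free terms. -/
noncomputable def tensorPowerBasis : Module.Basis (PowerIndex n j ι) R (TensorPower K n j) :=
  DFinsupp.basis fun i => Basis.piTensorProduct fun k => b (i.1 k)

lemma tensorPowerBasis_apply (x : PowerIndex n j ι) :
    tensorPowerBasis j b x = homog (fun k => ⟨x.1.1 k, b _ (x.2 k)⟩) x.1.2 := by
  obtain ⟨i, p⟩ := x
  classical
  refine (tensorPowerBasis j b).repr.injective ?_
  rw [Module.Basis.repr_self]
  refine Finsupp.ext fun ⟨i', p'⟩ => ?_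
  change _ = (Basis.piTensorProduct fun k => b (i'.1 k)).repr (DirectSum.lof R _
    (fun i : {i : Fin n → ℤ // ∑ k, i k = j} => ⨂[R] k, K.X (i.1 k)) i
      (PiTensorProduct.tprod R fun k => b (i.1 k) (p k)) i') p'
  by_cases h : i = i'
  · subst h
    rw [DirectSum.lof_apply, ← Basis.piTensorProduct_apply (fun k => b (i.1 k)),
      Module.Basis.repr_self]
    by_cases h : p = p'
    · subst h; simp
    · rw [Finsupp.single_eq_of_ne' h, Finsupp.single_eq_of_ne' (by simpa using h)]
  · rw [DirectSum.lof_eq_of, DirectSum.of_eq_of_ne _ _ _ (Ne.symm h), map_zero, Finsupp.zero_apply,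
      Finsupp.single_eq_of_ne' (fun hh => h (congrArg Sigma.fst hh))]

variable [Algebra ℂ R] [Algebra ℂ S] [Algebra ℂ T]

/-- The basis of a term of `V ⊗ K^{⊗ n}` for a complex with free terms. -/
noncomputable def twistedBasis :
    Module.Basis (κ × PowerIndex n j ι) R (TwistedPower V K n j) :=
  (Algebra.TensorProduct.basis R c).tensorProduct (tensorPowerBasis j b)

lemma twistedBasis_apply (x : κ × PowerIndex n j ι) :
    twistedBasis j b c x = ((1 : R) ⊗ₜ[ℂ] c x.1) ⊗ₜ[R]
      homog (fun k => ⟨x.2.1.1 k, b _ (x.2.2 k)⟩) x.2.1.2 := by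
  rw [← tensorPowerBasis_apply]
  exact (Module.Basis.tensorProduct_apply _ _ _ _).trans
    (by rw [Algebra.TensorProduct.basis_apply])

variable (V n) in
/-- The map on the terms of `V ⊗ K^{⊗ n}` induced by a homomorphism of `ℂ`-algebras `R → S` and
semilinear maps `K^a → L^a`. -/
noncomputable def twistedMap (φ : R →ₐ[ℂ] S) (r : ∀ a, K.X a →ₛₗ[(φ : R →+* S)] L.X a) :
    TwistedPower V K n j →ₛₗ[(φ : R →+* S)] TwistedPower V L n j :=
  TensorProduct.map (scalarMap V φ) (tensorPowerMap n j r)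

lemma twistedMap_twistedBasis (φ : R →ₐ[ℂ] S) (r : ∀ a, K.X a →ₛₗ[(φ : R →+* S)] L.X a)
    {b' : ∀ a, Module.Basis (ι a) S (L.X a)} (h : ∀ a k, r a (b a k) = b' a k)
    (x : κ × PowerIndex n j ι) :
    twistedMap n V j φ r (twistedBasis j b c x) = twistedBasis j b' c x := by
  rw [twistedBasis_apply, twistedBasis_apply]
  refine congrArg₂ (fun s t => s ⊗ₜ[S] t) (congrArg (fun t => t ⊗ₜ[ℂ] c x.1) (map_one φ))
    ((tensorPowerMap_homog _ _ _).trans (homog_congr ?_ _))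
  exact funext fun k => congrArg (Sigma.mk _) (h _ _)

lemma twistedMap_id (φ : R →ₐ[ℂ] R) (hφ : φ = AlgHom.id ℂ R)
    (r : ∀ a, K.X a →ₛₗ[(φ : R →+* R)] K.X a) (hr : ∀ a x, r a x = x)
    (x : TwistedPower V K n j) : twistedMap n V j φ r x = x := by
  subst hφ
  obtain rfl : r = fun a => (LinearMap.id : K.X a →ₗ[R] K.X a) :=
    funext fun a => LinearMap.ext (hr a)
  have h : twistedMap n V j (AlgHom.id ℂ R) (fun a => (LinearMap.id : K.X a →ₗ[R] K.X a)) =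
      LinearMap.id :=
    TensorProduct.ext' fun v t => congrArg₂ (fun a b => a ⊗ₜ[R] b)
      (LinearMap.congr_fun TensorProduct.map_id v) (tensorPowerMap_id t)
  exact LinearMap.congr_fun h x

lemma twistedMap_comp (φ : R →ₐ[ℂ] S) (ψ : S →ₐ[ℂ] T) (χ : R →ₐ[ℂ] T) (hχ : χ = ψ.comp φ)
    (r : ∀ a, K.X a →ₛₗ[(φ : R →+* S)] L.X a) (s : ∀ a, L.X a →ₛₗ[(ψ : S →+* T)] Q.X a)
    (t : ∀ a, K.X a →ₛₗ[(χ : R →+* T)] Q.X a)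
    (ht : ∀ a x, t a x = s a (r a x)) (x : TwistedPower V K n j) :
    twistedMap n V j χ t x = twistedMap n V j ψ s (twistedMap n V j φ r x) := by
  subst hχ
  have : RingHomCompTriple (φ : R →+* S) (ψ : S →+* T) ((ψ.comp φ : R →ₐ[ℂ] T) : R →+* T) :=
    ⟨rfl⟩
  obtain rfl : t = fun a => (s a).comp (r a) := funext fun a => LinearMap.ext (ht a)
  have h : twistedMap n V j (ψ.comp φ) (fun a => (s a).comp (r a)) =
      (twistedMap n V j ψ s).comp (twistedMap n V j φ r) := by
    refine TensorProduct.ext' fun v t => ?_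
    change _ ⊗ₜ[T] _ = _ ⊗ₜ[T] _
    rw [tensorPowerMap_comp]
    congr 1
    induction v using TensorProduct.induction_on with
    | zero => simp
    | tmul a v => rfl
    | add a b ha hb => simp only [map_add, ha, hb]
  exact LinearMap.congr_fun h x

lemma twistedMap_twistedRep (ρ : Representation ℂ (Equiv.Perm (Fin n)) V) (φ : R →ₐ[ℂ] S)
    (r : ∀ a, K.X a →ₛₗ[(φ : R →+* S)] L.X a) (σ : Equiv.Perm (Fin n)) (x : TwistedPower V K n j) :
    twistedMap n V j φ r (twistedRep ρ K j σ x) = twistedRep ρ L j σ (twistedMap n V j φ r x) := by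
  have h : (twistedRep ρ L j σ).comp (twistedMap n V j φ r) =
      (twistedMap n V j φ r).comp (twistedRep ρ K j σ) := by
    refine TensorProduct.ext' fun v t => ?_
    change _ ⊗ₜ[S] _ = _ ⊗ₜ[S] _
    congr 1
    · induction v using TensorProduct.induction_on with
      | zero => simp
      | tmul a v => rfl
      | add a b ha hb => simp only [map_add, ha, hb]
    · exact (tensorPowerMap_permMap r σ t).symm
  exact (LinearMap.congr_fun h x).symm

lemma schurProj_twistedMap (ρ : Representation ℂ (Equiv.Perm (Fin n)) V) (φ : R →ₐ[ℂ] S)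
    (r : ∀ a, K.X a →ₛₗ[(φ : R →+* S)] L.X a) (x : TwistedPower V K n j) :
    schurProj ρ L j (twistedMap n V j φ r x) = schurMap ρ j φ r (schurProj ρ K j x) := by
  refine Subtype.ext ?_
  change average ρ L j (twistedMap n V j φ r x) = twistedMap n V j φ r (average ρ K j x)
  simp only [average_apply, map_smulₛₗ, map_sum, twistedMap_twistedRep]
  exact congrArg (· • _) (φ.commutes _).symm

end TwistedBasis

section PresheafTerm

open Opposite

variable {M : Scheme.{0}} {E : M.Modules}

lemma exists_open_forall {ι : Type*} {s : Set ι} (hs : s.Finite) {p : ι → M.Opens → Prop}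
    (anti : ∀ i, Antitone (p i)) (x : M) (h : ∀ i ∈ s, ∃ U : M.Opens, x ∈ U ∧ p i U)
    (htop : ∀ i ∉ s, p i ⊤) : ∃ U : M.Opens, x ∈ U ∧ ∀ i, p i U := by
  have : Finite s := hs
  choose U hxU hU using h
  obtain ⟨W, hW⟩ := Finite.exists_ge fun i : s =>
    (⟨U i i.2, hxU i i.2⟩ : TopologicalSpace.OpenNhdsOf x)
  refine ⟨W.1, W.2, fun i => ?_⟩
  by_cases hi : i ∈ s
  · exact anti i (hW ⟨i, hi⟩) (hU i hi)
  · exact anti i le_top (htop i hi)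

lemma Sect.subsingleton_of_isZero (hE : Limits.IsZero E) (V : M.Opens) :
    Subsingleton (Sect E.val V) :=
  subsingleton_of_forall_eq 0 fun x =>
    congrArg (fun f : E ⟶ E => Scheme.Modules.Hom.app f V x) (hE.eq_of_src (𝟙 E) 0)

lemma exists_frames {E : ℤ → M.Modules} {a b : ℤ}
    (hE : ∀ i, i < a ∨ b < i → Limits.IsZero (E i)) (h : ∀ i, IsLocallyFree (E i).val) (x : M) :
    ∃ U : M.Opens, x ∈ U ∧ ∃ (r : ℤ → ℕ) (e : ∀ i, Fin (r i) → Sect (E i).val U),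
      Finite (Σ i, Fin (r i)) ∧ ∀ i, IsFrame (e i) := by
  obtain ⟨U, hx, hU⟩ := exists_open_forall (s := Set.Icc a b) (Set.finite_Icc a b)
    (p := fun i U => ∃ (r : ℕ) (e : Fin r → Sect (E i).val U), (i ∉ Set.Icc a b → r = 0) ∧
      IsFrame e)
    (fun i U V hVU ⟨r, e, hr, he⟩ => ⟨r, _, hr, he.res hVU⟩) x
    (fun i hi =>
      have ⟨U, hx, r, e, he⟩ := h i x
      ⟨U, hx, r, e, absurd hi, he⟩)
    (fun i hi => ⟨0, Fin.elim0, fun _ => rfl, .of_subsingleton fun V _ =>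
      Sect.subsingleton_of_isZero (hE i (by rw [Set.mem_Icc] at hi; omega)) V⟩)
  choose r e hr he using hU
  refine ⟨U, hx, r, e, ?_, he⟩
  refine Finite.of_injective (β := Σ i : Set.Icc a b, Fin (r i))
    (fun s => ⟨⟨s.1, by_contra fun hs => (hr _ hs ▸ s.2).elim0⟩, s.2⟩) ?_
  rintro ⟨i, k⟩ ⟨i', k'⟩ h
  simp only [Sigma.mk.injEq, Subtype.mk.injEq] at h
  obtain ⟨rfl, h⟩ := h
  simpa using h

variable [M.Over (Spec (CommRingCat.of ℂ))] (P : CochainComplex M.Modules ℤ) {n : ℕ} {V : Type}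
  [AddCommGroup V] [Module ℂ V] (ρ : Representation ℂ (Equiv.Perm (Fin n)) V) (j : ℤ)

variable (n V) in
/-- The presheaf `U ↦ V ⊗ P(U)^{⊗ n}` in degree `j`, as a presheaf of abelian groups. -/
noncomputable def twistedPresheafAb : M.Opensᵒᵖ ⥤ Ab.{0} where
  obj U := AddCommGrpCat.of (TwistedPower V (sections P U.unop) n j)
  map i := AddCommGrpCat.ofHom
    (twistedMap n V j (resAlgHom i.unop) (sectionsRes P i.unop)).toAddMonoidHom
  map_id U := AddCommGrpCat.hom_ext <| AddMonoidHom.ext fun x =>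
    twistedMap_id j (resAlgHom (𝟙 U).unop)
      (AlgHom.ext fun r => ConcreteCategory.congr_hom (M.presheaf.map_id U) r) _
      (fun a x => ConcreteCategory.congr_hom ((P.X a).presheaf.map_id U) x) x
  map_comp i k := AddCommGrpCat.hom_ext <| AddMonoidHom.ext fun x =>
    twistedMap_comp j (resAlgHom i.unop) (resAlgHom k.unop) (resAlgHom (i ≫ k).unop)
      (AlgHom.ext fun r => ConcreteCategory.congr_hom (M.presheaf.map_comp i k) r)
      (sectionsRes P i.unop) (sectionsRes P k.unop) (sectionsRes P (i ≫ k).unop)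
      (fun a x => ConcreteCategory.congr_hom ((P.X a).presheaf.map_comp i k) x) x

variable (n V) in
/-- The presheaf of modules `U ↦ V ⊗ P(U)^{⊗ n}` in degree `j`. -/
noncomputable def twistedPresheaf : M.PresheafOfModules :=
  letI : ∀ U, Module (M.ringCatSheaf.obj.obj U) ((twistedPresheafAb P n V j).obj U) := fun U =>
    inferInstanceAs (Module Γ(M, U.unop) (TwistedPower V (sections P U.unop) n j))
  PresheafOfModules.ofPresheaf (twistedPresheafAb P n V j) fun _ _ i r x =>
    (twistedMap n V j (resAlgHom i.unop) (sectionsRes P i.unop)).map_smulₛₗ r x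

variable {P} in
lemma IsFrame.twistedPresheaf {U : M.Opens} {ι : ℤ → Type}
    {e : ∀ a, ι a → Sect (P.X a).val U} (he : ∀ a, IsFrame (e a)) {κ : Type}
    (c : Module.Basis κ ℂ V) :
    IsFrame (G := twistedPresheaf P n V j) (U := U)
      (twistedBasis j (K := sections P U) (fun a => (he a).basis le_rfl) c) :=
  .of_basis (fun _ h => twistedBasis j (K := sections P _) (fun a => (he a).basis h) c)
    fun _ h x => (twistedMap_twistedBasis j (K := sections P U) (L := sections P _)
      (fun a => (he a).basis le_rfl) c (resAlgHom (homOfLE h)) (sectionsRes P (homOfLE h))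
      (fun a k => (congrArg (Sect.res h) ((he a).basis_apply le_rfl k)).trans
        ((Sect.res_res le_rfl h _).trans ((he a).basis_apply h k).symm)) x).symm

lemma isLocallyFree_presheafTerm [Module.Finite ℂ V] (hP : IsBoundedComplex P)
    (h : ∀ a, IsLocallyFree (P.X a).val) : IsLocallyFree (presheafTerm ρ P j) := by
  obtain ⟨a, b, hab⟩ := hP
  intro x
  obtain ⟨U, hx, r, e, hr, he⟩ := exists_frames hab h x
  have := finite_powerIndex (n := n) (j := j) (ι := fun a => Fin (r a))
  let i : HomOver U (presheafTerm ρ P j) (twistedPresheaf P n V j) :=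
    { app W _ := (schurTerm ρ (sections P W) j).subtype
      app_res _ _ _ := rfl }
  let p : HomOver U (twistedPresheaf P n V j) (presheafTerm ρ P j) :=
    { app W _ := schurProj ρ (sections P W) j
      app_res _ h' := schurProj_twistedMap j ρ (resAlgHom (homOfLE h'))
        (sectionsRes P (homOfLE h')) }
  obtain ⟨W, -, hxW, hW⟩ := (IsFrame.twistedPresheaf (n := n) j he
    (Module.finBasis ℂ V)).exists_isFrame_of_retract i p (fun W _ => schurProj_coe ρ) hx
  exact ⟨W, hxW, hW⟩

end PresheafTerm

section VectorBundle

variable {M : Scheme.{0}} {U V : M.Opens} {E E' : M.Modules} {ι : Type}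

lemma Sect.map_sum (s : Finset ι) (f : ι → (E ⟶ E')) (x : Sect E.val V) :
    Sect.map (∑ k ∈ s, f k).val V x = ∑ k ∈ s, Sect.map (f k).val V x :=
  _root_.map_sum (AddMonoidHom.mk' (fun g : E ⟶ E' => Sect.map g.val V x) fun _ _ => rfl) f s

lemma isIso_iff_bijective (f : E ⟶ E') :
    IsIso f ↔ ∀ V, Function.Bijective (Sect.map f.val V) :=
  Scheme.Modules.Hom.isIso_iff_isIso_app.trans <| forall_congr' fun V =>
    ConcreteCategory.isIso_iff_bijective (Scheme.Modules.Hom.app f V)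

lemma IsFrame.map_of_isIso {e : ι → Sect E.val U} (he : IsFrame e) (f : E ⟶ E') [IsIso f] :
    IsFrame fun k => Sect.map f.val U (e k) :=
  of_basis (fun V h => (he.basis h).map
    (.ofBijective (Sect.map f.val V) ((isIso_iff_bijective f).mp inferInstance V)))
    fun V h k => (congrArg (Sect.map f.val V) (he.basis_apply h k)).trans
      (Sect.map_res f.val h (e k))

lemma IsLocallyFree.of_iso (h : IsLocallyFree E.val) (f : E ≅ E') : IsLocallyFree E'.val := by
  intro x
  obtain ⟨U, hx, r, e, he⟩ := h x
  exact ⟨U, hx, r, _, he.map_of_isIso f.hom⟩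

variable (M) in
/-- The structure sheaf, as a sheaf of modules. -/
noncomputable def structureSheaf : M.Modules := SheafOfModules.unit M.ringCatSheaf

variable (M) in
/-- The free sheaf of modules on the type `ι`. -/
noncomputable def freeModules (ι : Type) : M.Modules := SheafOfModules.free ι

/-- A section of the structure sheaf is a function. -/
noncomputable def functionEquiv (V : M.Opens) :
    Γ(M, V) ≃ₗ[Γ(M, V)] Sect (structureSheaf M).val V where
  toFun a := a
  invFun a := a
  map_add' _ _ := rfl
  map_smul' _ _ := rfl

lemma isFrame_of_sum_eq_id [Fintype ι] [DecidableEq ι]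
    (i : ι → (structureSheaf M ⟶ E)) (p : ι → (E ⟶ structureSheaf M))
    (hip : ∀ k j, i k ≫ p j = if k = j then 𝟙 _ else 0) (hpi : ∑ j, p j ≫ i j = 𝟙 E)
    {e : ι → Sect E.val U}
    (he : ∀ V (h : V ≤ U) k, Sect.res h (e k) = Sect.map (i k).val V (functionEquiv V 1)) :
    IsFrame e := by
  have hip' (V) (k j) (a : Γ(M, V)) :
      Sect.map (p j).val V (Sect.map (i k).val V (functionEquiv V a)) =
        functionEquiv V (if k = j then a else 0) := by
    change Sect.map (i k ≫ p j).val V _ = _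
    rw [hip]
    split_ifs <;> rfl
  have hpi' (V) (x : Sect E.val V) :
      ∑ j, Sect.map (i j).val V (Sect.map (p j).val V x) = x := by
    refine (Sect.map_sum Finset.univ (fun j => p j ≫ i j) x).symm.trans ?_
    rw [hpi]
    rfl
  let b (V : M.Opens) : Sect E.val V ≃ₗ[Γ(M, V)] (ι → Γ(M, V)) := .ofLinearMap
    (.pi fun j => (functionEquiv V).symm.toLinearMap ∘ₗ Sect.map (p j).val V)
    (∑ k, Sect.map (i k).val V ∘ₗ (functionEquiv V).toLinearMap ∘ₗ .proj k)
    (by ext; simp [hip'])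
    (by ext; simp [hpi'])
  exact .of_basis (fun V _ => .ofEquivFun (b V)) fun V h k => by
    rw [he, Module.Basis.coe_ofEquivFun]
    exact (LinearMap.sum_apply ..).trans <| (Finset.sum_eq_single k
      (fun j _ hj => by simp [hj]) (by simp)).trans (by simp)

/-- The tautological frame of a free sheaf of modules. -/
noncomputable def freeFrame (ι : Type) (k : ι) : Sect (freeModules M ι).val ⊤ :=
  (SheafOfModules.freeSection (R := M.ringCatSheaf) k).eval (.op ⊤)

lemma isFrame_freeFrame [Finite ι] : IsFrame (freeFrame (M := M) ι) := by
  classical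
  have := Fintype.ofFinite ι
  let hfree := SheafOfModules.isColimitFreeCofan (R := M.ringCatSheaf) ι
  let i : ι → (structureSheaf M ⟶ freeModules M ι) := SheafOfModules.ιFree
  let δ (k j : ι) : structureSheaf M ⟶ structureSheaf M := if k = j then 𝟙 _ else 0
  let p (j : ι) : freeModules M ι ⟶ structureSheaf M :=
    Limits.Cofan.IsColimit.desc hfree fun k => δ k j
  have hip (k j) : i k ≫ p j = δ k j := Limits.Cofan.IsColimit.fac hfree (fun k => δ k j) k
  refine isFrame_of_sum_eq_id i p hip ?_ fun V h k =>
    PresheafOfModules.sections_property (SheafOfModules.freeSection (R := M.ringCatSheaf) k)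
      (homOfLE h).op
  refine Limits.Cofan.IsColimit.hom_ext hfree _ _ fun k => ?_
  change i k ≫ ∑ j, p j ≫ i j = i k ≫ 𝟙 _
  simp [Preadditive.comp_sum, ← Category.assoc, hip, δ, ite_comp]

lemma IsFrame.nonempty_iso_free [Finite ι] {e : ι → Sect E.val ⊤} (he : IsFrame e) :
    Nonempty (E ≅ freeModules M ι) := by
  let s (k : ι) : SheafOfModules.sections E :=
    PresheafOfModules.sectionsMk (fun V => Sect.res (le_top : V.unop ≤ ⊤) (e k))
      fun V W f => Sect.res_res (le_top : V.unop ≤ ⊤) (leOfHom f.unop) (e k)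
  let φ : freeModules M ι ⟶ E := (SheafOfModules.freeHomEquiv E).symm s
  have hφ (V : M.Opens) (k : ι) :
      Sect.map φ.val V (Sect.res le_top (freeFrame ι k)) = Sect.res le_top (e k) := by
    have hs := congrArg (fun t : SheafOfModules.sections E => t.eval (.op ⊤))
      (SheafOfModules.sectionsMap_freeHomEquiv_symm_freeSection (R := M.ringCatSheaf) s k)
    rw [Sect.map_res]
    exact (congrArg (Sect.res le_top) hs).trans (Sect.res_res le_rfl le_top (e k))
  have : IsIso φ := by
    refine (isIso_iff_bijective φ).mpr fun V => ?_
    let b := (isFrame_freeFrame (ι := ι)).basis (le_top : V ≤ ⊤)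
    have h : Sect.map φ.val V = b.equiv (he.basis le_top) (Equiv.refl ι) :=
      b.ext fun k => by
        rw [LinearEquiv.coe_coe, Module.Basis.equiv_apply, IsFrame.basis_apply,
          IsFrame.basis_apply, hφ, Equiv.refl_apply]
    rw [h]
    exact LinearEquiv.bijective _
  exact ⟨(asIso φ).symm⟩

lemma restrict_smul (E : M.Modules) {V : (U : Scheme.{0}).Opens} (c : Γ((U : Scheme.{0}), V))
    (x : Sect (E.restrict U.ι).val V) :
    c • x = (show Sect E.val (U.ι ''ᵁ V) from
      (show Γ(M, U.ι ''ᵁ V) from c) • (show Sect E.val (U.ι ''ᵁ V) from x)) := by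
  have hc : (U.ι.appIso V).inv c = (show Γ(M, U.ι ''ᵁ V) from c) := by
    rw [Scheme.Opens.ι_appIso]; rfl
  exact (Scheme.Modules.smul_restrictAppIso_hom_apply U.ι E V c x).trans
    (congrArg (fun a : Γ(M, U.ι ''ᵁ V) => a • (show Sect E.val (U.ι ''ᵁ V) from x)) hc)

lemma isFrame_iff_bijective [Fintype ι] {F : M.PresheafOfModules} {e : ι → Sect F U} :
    IsFrame e ↔ ∀ (V : M.Opens) (h : V ≤ U),
      Function.Bijective fun c : ι → Γ(M, V) => ∑ k, c k • Sect.res h (e k) := by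
  refine forall₂_congr fun V h => and_congr ?_ ?_
  · exact linearIndependent_iff_injective_fintypeLinearCombination
  · rw [← Fintype.range_linearCombination, LinearMap.range_eq_top]
    rfl

lemma isFrame_restrict_iff [Finite ι] {e : ι → Sect E.val (U.ι ''ᵁ ⊤)} :
    IsFrame (show ι → Sect (E.restrict U.ι).val ⊤ from e) ↔ IsFrame e := by
  have := Fintype.ofFinite ι
  rw [isFrame_iff_bijective, isFrame_iff_bijective]
  simp only [restrict_smul]
  refine ⟨fun h V hV => ?_, fun h V hV => h (U.ι ''ᵁ V) (Scheme.Hom.image_mono _ hV)⟩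
  obtain ⟨W, rfl⟩ : ∃ W, V = U.ι ''ᵁ W := by
    refine ⟨U.ι ⁻¹ᵁ V, ?_⟩
    rw [Scheme.Hom.image_preimage_eq_opensRange_inf, Scheme.Opens.opensRange_ι]
    rw [Scheme.Hom.image_top_eq_opensRange, Scheme.Opens.opensRange_ι] at hV
    exact (inf_eq_right.mpr hV).symm
  exact h W le_top

lemma isVectorBundle_iff (E : M.Modules) : isVectorBundle M E ↔ IsLocallyFree E.val := by
  refine ⟨fun h x => ?_, fun h x => ?_⟩
  · obtain ⟨U, hx, r, ⟨f⟩⟩ := h x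
    let g : E.restrict U.ι ≅ freeModules U.toScheme (Fin r) := f
    exact ⟨U.ι ''ᵁ ⊤, by simpa using hx, r, _,
      isFrame_restrict_iff.mp (isFrame_freeFrame.map_of_isIso g.inv)⟩
  · obtain ⟨U, hx, r, e, he⟩ := h x
    exact ⟨U, hx, r, (isFrame_restrict_iff.mpr
      (he.res (V := U.ι ''ᵁ ⊤) (by simp))).nonempty_iso_free⟩

/-- An equivalence preserving the unit preserves free sheaves of modules. -/
noncomputable def mapFreeIsoOfIsEquivalence {C D : Type*} [Category* C] [Category* D]
    {J : GrothendieckTopology C} {K : GrothendieckTopology D}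
    [HasSheafify J AddCommGrpCat.{0}] [J.WEqualsLocallyBijective AddCommGrpCat.{0}]
    [HasSheafify K AddCommGrpCat.{0}] [K.WEqualsLocallyBijective AddCommGrpCat.{0}]
    {R : Sheaf J RingCat.{0}} {S : Sheaf K RingCat.{0}}
    (F : SheafOfModules.{0} R ⥤ SheafOfModules.{0} S) [F.IsEquivalence] (ι : Type)
    (η : F.obj (.unit R) ≅ .unit S) : SheafOfModules.free (R := S) ι ≅ F.obj (.free ι) :=
  SheafOfModules.mapFreeIso F ι η.symm

open SheafOfModules in
lemma isQuasicoherent_and_isFiniteType_of_free {C : Type*} [Category* C]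
    {J : GrothendieckTopology C} {R : Sheaf J RingCat.{0}}
    [∀ X, HasSheafify (J.over X) AddCommGrpCat.{0}]
    [∀ X, (J.over X).WEqualsLocallyBijective AddCommGrpCat.{0}] {E : SheafOfModules R} {I : Type*}
    {X : I → C} (hX : J.CoversTop X) {ι : I → Type} [∀ i, Finite (ι i)]
    (e : ∀ i, free (ι i) ≅ E.over (X i)) : E.IsQuasicoherent ∧ E.IsFiniteType := by
  let q : LocalGeneratorsData E :=
    { I := I
      X := X
      coversTop := hX
      generators i := (free.generatingSections (ι i)).ofEpi (e i).hom }
  have (i : I) : IsIso ((free.generatingSections (ι i)).ofEpi (e i).hom).π := by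
    rw [GeneratingSections.ofEpi_π, free.generatingSections_π]
    exact (Category.id_comp (e i).hom).symm ▸ (e i).isIso_hom
  have : q.IsLocallyFreeData := ⟨this⟩
  exact ⟨q.quasiCoherentData.isQuasicoherent, q.shrink,
    ⟨fun i => ⟨inferInstanceAs (Finite (ι i.2.choose))⟩⟩⟩

/-- A trivialization of the restriction of `E` to `U`, as an isomorphism of sheaves on the slice
site over `U`. -/
noncomputable def freeIsoOver (e : E.restrict U.ι ≅ freeModules U.toScheme ι) :
    SheafOfModules.free ι ≅ SheafOfModules.over E U :=
  mapFreeIsoOfIsEquivalence (U.sheafOfModulesEquivOver M.ringCatSheaf).inverse ι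
      (U.sheafOfModulesEquivOverInverseUnit M.ringCatSheaf) ≪≫
    (Scheme.Modules.overEquiv U).inverse.mapIso
      (e.symm ≪≫ ((Scheme.Modules.overFunctorEquiv U).app E).symm) ≪≫
    ((Scheme.Modules.overEquiv U).unitIso.app _).symm

end VectorBundle

end SchurComplex

lemma isVectorBundle.isCoherent {M : Scheme.{0}} {E : M.Modules} (h : isVectorBundle M E) :
    isCoherent M E := by
  choose U hU r hr using h
  exact SchurComplex.isQuasicoherent_and_isFiniteType_of_free
    ((Opens.coversTop_iff _ U).mpr (.mk (top_unique fun x _ =>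
      TopologicalSpace.Opens.mem_iSup.mpr ⟨x, hU x⟩)))
    fun x => SchurComplex.freeIsoOver (hr x).some

namespace SchurComplex

section Exactness

variable {M : Scheme.{0}} {U V W : M.Opens} {E F : M.Modules} {S : ShortComplex M.Modules}

variable (V) in
/-- The functor of sections over `V`. -/
noncomputable def sectionsFunctor : M.Modules ⥤ Ab.{0} :=
  Scheme.Modules.toPresheaf M ⋙ (evaluation _ _).obj (.op V)

noncomputable instance : Limits.PreservesLimits (sectionsFunctor V) :=
  have : Limits.PreservesLimits ((evaluation M.Opensᵒᵖ Ab.{0}).obj (.op V)) :=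
    ⟨fun {_} _ => ⟨inferInstance⟩⟩
  Limits.comp_preservesLimits _ _

instance : (sectionsFunctor V).PreservesZeroMorphisms := ⟨fun _ _ => rfl⟩

namespace Sect

lemma map_injective_of_mono (f : E ⟶ F) [Mono f] (V : M.Opens) :
    Function.Injective (map f.val V) :=
  have : Mono ((sectionsFunctor V).map f) := inferInstance
  (AddCommGrpCat.mono_iff_injective _).mp this

lemma exists_map_f_eq (hS : S.Exact) [Mono S.f] {x : Sect S.X₂.val V} (hx : map S.g.val V x = 0) :
    ∃ y, map S.f.val V y = x :=
  (ShortComplex.ab_exact_iff _).mp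
    (hS.map_of_mono_of_preservesKernel (sectionsFunctor V) ‹_› inferInstance) x hx

/-- The quotient of `F` by the image of `f` as a presheaf sheafifies to zero. -/
lemma exists_map_eq_res_of_epi (f : E ⟶ F) [Epi f] (y : Sect F.val V) {p : M} (hp : p ∈ V) :
    ∃ (W : M.Opens) (hW : W ≤ V), p ∈ W ∧ ∃ x, map f.val W x = res hW y := by
  let Φ := Scheme.Modules.toPresheafOfModules M
  let π := Limits.cokernel.π (Φ.map f)
  have hπ : π ≫ toSheafify _ = 0 := by
    let t : F ⟶ (sheafify M).obj (Limits.cokernel (Φ.map f)) := Φ.preimage (π ≫ toSheafify _)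
    have ht : t = 0 := by
      rw [← cancel_epi f, Limits.comp_zero]
      exact Φ.map_injective <| (Φ.map_comp f t).trans <|
        (congrArg (Φ.map f ≫ ·) (Φ.map_preimage _)).trans <|
        (Limits.cokernel.condition_assoc _ _).trans <| Limits.zero_comp
    exact (Φ.map_preimage _).symm.trans (congrArg Φ.map ht)
  obtain ⟨W, hW, hpW, h0⟩ := exists_res_eq_zero (toSheafify _) (x := map π V y)
    (congrArg (fun g => map g V y) hπ) hp
  have hexact := (ShortComplex.exact_of_g_is_cokernel (.mk (Φ.map f) π (by simp [π]))
    (Limits.cokernelIsCokernel (Φ.map f))).map (PresheafOfModules.evaluation _ (.op W))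
  exact ⟨W, hW, hpW, (ShortComplex.moduleCat_exact_iff _).mp hexact _
    ((map_res π hW y).trans h0)⟩

end Sect

/-- The restriction to `U` of a morphism defined everywhere. -/
noncomputable def HomOver.ofHom (f : E ⟶ F) (U : M.Opens) : HomOver U E.val F.val where
  app V _ := Sect.map f.val V
  app_res _ h' x := Sect.map_res f.val h' x

/-- A splitting over `W` of a short exact sequence of sheaves of modules. -/
structure SplittingOver (S : ShortComplex M.Modules) (W : M.Opens) where
  r : HomOver W S.X₂.val S.X₁.val
  s : HomOver W S.X₃.val S.X₂.val
  r_f : ∀ V h x, r.app V h (Sect.map S.f.val V x) = x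
  g_s : ∀ V h x, Sect.map S.g.val V (s.app V h x) = x
  f_r_add_s_g : ∀ V h x,
    Sect.map S.f.val V (r.app V h x) + s.app V h (Sect.map S.g.val V x) = x

namespace SplittingOver

/-- The restriction of a splitting to a smaller open subset. -/
def res (σ : SplittingOver S U) (h : V ≤ U) : SplittingOver S V where
  r := σ.r.res h
  s := σ.s.res h
  r_f W hW := σ.r_f W (hW.trans h)
  g_s W hW := σ.g_s W (hW.trans h)
  f_r_add_s_g W hW := σ.f_r_add_s_g W (hW.trans h)

lemma map_g_map_f (S : ShortComplex M.Modules) (x : Sect S.X₁.val V) :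
    Sect.map S.g.val V (Sect.map S.f.val V x) = 0 :=
  congrArg (fun f : S.X₁ ⟶ S.X₃ => Sect.map f.val V x) S.zero

/-- The splitting of a short exact sequence given by a section of its epimorphism. -/
noncomputable def ofSection (hS : S.ShortExact) (s : HomOver W S.X₃.val S.X₂.val)
    (hs : ∀ V h x, Sect.map S.g.val V (s.app V h x) = x) : SplittingOver S W :=
  have := hS.mono_f
  have inj (V : M.Opens) : Function.Injective (Sect.map S.f.val V) :=
    Sect.map_injective_of_mono S.f V
  let q (V : M.Opens) (h : V ≤ W) : Sect S.X₂.val V →ₗ[Γ(M, V)] Sect S.X₂.val V :=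
    LinearMap.id - s.app V h ∘ₗ Sect.map S.g.val V
  have hq (V h x) : q V h x ∈ (Sect.map S.f.val V).range :=
    Sect.exists_map_f_eq hS.exact (by simp [q, hs])
  let r (V : M.Opens) (h : V ≤ W) : Sect S.X₂.val V →ₗ[Γ(M, V)] Sect S.X₁.val V :=
    (q V h).codRestrictOfInjective _ (inj V) (hq V h)
  have f_r (V h x) : Sect.map S.f.val V (r V h x) = x - s.app V h (Sect.map S.g.val V x) :=
    LinearMap.codRestrictOfInjective_comp_apply _ _ (inj V) (hq V h) x
  { r :=
      { app := r
        app_res := fun h h' x => inj _ (by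
          rw [f_r, Sect.map_res, Sect.map_res, f_r, s.app_res h, map_sub]) }
    s := s
    r_f := fun V h x => inj V (by simp [f_r, map_g_map_f])
    g_s := hs
    f_r_add_s_g := fun V h x => by simp [f_r] }

/-- The splitting of a short exact sequence given by lifts of a frame. -/
noncomputable def ofFrame (hS : S.ShortExact) {ι : Type*} {e : ι → Sect S.X₃.val W}
    (he : IsFrame e) (y : ι → Sect S.X₂.val W) (hy : ∀ k, Sect.map S.g.val W (y k) = e k) :
    SplittingOver S W :=
  let s (V : M.Opens) (h : V ≤ W) : Sect S.X₃.val V →ₗ[Γ(M, V)] Sect S.X₂.val V :=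
    (he.basis h).constr Γ(M, V) fun k => Sect.res h (y k)
  have s_res (V h) (k : ι) : s V h (Sect.res h (e k)) = Sect.res h (y k) := by
    rw [← he.basis_apply, Module.Basis.constr_basis]
  ofSection hS
    { app := s
      app_res := fun {V V'} h h' x => by
        induction (he.basis h).mem_span x using Submodule.span_induction with
        | mem x hx =>
          obtain ⟨k, rfl⟩ := hx
          rw [he.basis_apply, Sect.res_res, s_res, s_res, Sect.res_res]
        | zero => simp only [map_zero]
        | add x y _ _ hx hy => simp only [map_add, hx, hy]
        | smul a x _ hx => simp only [map_smul, map_smulₛₗ, hx] }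
    fun V h => LinearMap.congr_fun (f := Sect.map S.g.val V ∘ₗ s V h) (g := .id)
      ((he.basis h).ext fun k => by
        simp [he.basis_apply, s_res, Sect.map_res, hy])

lemma r_s (σ : SplittingOver S W) (h : V ≤ W) (z : Sect S.X₃.val V) :
    σ.r.app V h (σ.s.app V h z) = 0 := by
  have hf : Sect.map S.f.val V (σ.r.app V h (σ.s.app V h z)) = 0 := by
    simpa [σ.g_s] using σ.f_r_add_s_g V h (σ.s.app V h z)
  rw [← σ.r_f V h (σ.r.app V h _), hf, map_zero]

/-- The isomorphism of modules of sections given by a splitting. -/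
noncomputable def prodEquiv (σ : SplittingOver S W) (h : V ≤ W) :
    (Sect S.X₁.val V × Sect S.X₃.val V) ≃ₗ[Γ(M, V)] Sect S.X₂.val V :=
  .ofLinearMap ((Sect.map S.f.val V).coprod (σ.s.app V h))
    ((σ.r.app V h).prod (Sect.map S.g.val V))
    (LinearMap.ext fun x => by simpa using σ.f_r_add_s_g V h x)
    (LinearMap.ext fun x => by ext <;> simp [σ.r_f, σ.r_s, σ.g_s, map_g_map_f])

end SplittingOver

lemma exists_splittingOver (hS : S.ShortExact) (h₃ : IsLocallyFree S.X₃.val) (x : M) :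
    ∃ W : M.Opens, x ∈ W ∧ Nonempty (SplittingOver S W) := by
  obtain ⟨U, hx, r, e, he⟩ := h₃ x
  have := hS.epi_g
  obtain ⟨W, hxW, hW⟩ := exists_open_forall Set.finite_univ
    (p := fun k W => ∃ (h : W ≤ U) (y : _), Sect.map S.g.val W y = Sect.res h (e k))
    (fun k W W' h' ⟨h, y, hy⟩ => ⟨h'.trans h, Sect.res h' y, by
      rw [Sect.map_res, hy, Sect.res_res]⟩) x
    (fun k _ =>
      have ⟨W, hW, hxW, y, hy⟩ := Sect.exists_map_eq_res_of_epi S.g (e k) hx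
      ⟨W, hxW, hW, y, hy⟩)
    (fun k hk => absurd (Set.mem_univ k) hk)
  choose hWU y hy using hW
  exact ⟨U ⊓ W, ⟨hx, hxW⟩, ⟨.ofFrame hS (he.res inf_le_left) (fun k => Sect.res inf_le_right (y k))
    fun k => by rw [Sect.map_res, hy, Sect.res_res]⟩⟩

lemma isLocallyFree_of_isZero (hE : Limits.IsZero E) : IsLocallyFree E.val := fun _ =>
  ⟨⊤, trivial, 0, Fin.elim0, .of_subsingleton fun V _ => Sect.subsingleton_of_isZero hE V⟩

namespace IsLocallyFree

lemma of_shortExact (hS : S.ShortExact) (h₂ : IsLocallyFree S.X₂.val)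
    (h₃ : IsLocallyFree S.X₃.val) : IsLocallyFree S.X₁.val := by
  intro x
  obtain ⟨U, hxU, r, e, he⟩ := h₂ x
  obtain ⟨W, hxW, ⟨σ⟩⟩ := exists_splittingOver hS h₃ x
  obtain ⟨W', -, hx, n, g, hg⟩ := (he.res (inf_le_left : U ⊓ W ≤ U)).exists_isFrame_of_retract
    (.ofHom S.f _) (σ.res inf_le_right).r (σ.res inf_le_right).r_f ⟨hxU, hxW⟩
  exact ⟨W', hx, n, g, hg⟩

lemma extension (hS : S.ShortExact) (h₁ : IsLocallyFree S.X₁.val)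
    (h₃ : IsLocallyFree S.X₃.val) : IsLocallyFree S.X₂.val := by
  intro x
  obtain ⟨U₁, hx₁, r₁, e₁, he₁⟩ := h₁ x
  obtain ⟨U₃, hx₃, r₃, e₃, he₃⟩ := h₃ x
  obtain ⟨W, hxW, ⟨σ⟩⟩ := exists_splittingOver hS h₃ x
  let U := U₁ ⊓ U₃ ⊓ W
  have hU₁ : U ≤ U₁ := inf_le_left.trans inf_le_left
  have hU₃ : U ≤ U₃ := inf_le_left.trans inf_le_right
  have hUW : U ≤ W := inf_le_right
  have he : IsFrame (Sum.elim (fun k => Sect.map S.f.val U (Sect.res hU₁ (e₁ k)))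
      fun k => σ.s.app U hUW (Sect.res hU₃ (e₃ k))) :=
    .of_basis (fun V h => ((he₁.basis (h.trans hU₁)).prod (he₃.basis (h.trans hU₃))).map
      (σ.prodEquiv (h.trans hUW))) (by
        rintro V h (k | k)
        · simp [SplittingOver.prodEquiv, IsFrame.basis_apply, ← Sect.map_res, Sect.res_res]
        · simp [SplittingOver.prodEquiv, IsFrame.basis_apply, ← σ.s.app_res, Sect.res_res])
  exact ⟨U, ⟨⟨hx₁, hx₃⟩, hxW⟩, _, _, he.reindex finSumFinEquiv.symm⟩

end IsLocallyFree

end Exactness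

section Acyclic

variable {C : Type*} [Category* C]

/-- The contraction of a complex `K` whose differential factors as `K^i ⟶ Z^j ⟶ K^j`, with
`Z^i ⟶ K^i ⟶ Z^j` split exact for `i + 1 = j`. -/
noncomputable def contraction [Preadditive C] {K : CochainComplex C ℤ}
    {Z : ℤ → C} (f : ∀ i, Z i ⟶ K.X i) (g : ∀ i j, K.X i ⟶ Z j) (r : ∀ i, K.X i ⟶ Z i)
    (s : ∀ i j, i + 1 = j → (Z j ⟶ K.X i)) (g_f : ∀ i j, g i j ≫ f j = K.d i j)
    (f_r : ∀ i, f i ≫ r i = 𝟙 _) (s_g : ∀ i j hij, s i j hij ≫ g i j = 𝟙 _)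
    (r_f_add_g_s : ∀ i j hij, r i ≫ f i + g i j ≫ s i j hij = 𝟙 _) : Homotopy (𝟙 K) 0 :=
  have h : 𝟙 K = Homotopy.nullHomotopicMap' fun i j hij => r i ≫ s j i hij := by
    ext i
    have hprev : i - 1 + 1 = i := sub_add_cancel i 1
    rw [Homotopy.nullHomotopicMap'_f (c := .up ℤ) (k₂ := i - 1) (k₀ := i + 1) hprev rfl, ← g_f,
      ← g_f, Category.assoc, reassoc_of% f_r, Category.assoc, reassoc_of% s_g (i - 1) i hprev,
      add_comm, r_f_add_g_s]
    rfl
  (Homotopy.ofEq h).trans (Homotopy.nullHomotopy' _)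

variable [Abelian C] {K : CochainComplex C ℤ} {A : ObjectProperty C}

/-- The sequence `Z^i ⟶ K^i ⟶ Z^j` of a cochain complex, which is meant for `i + 1 = j`. -/
noncomputable def cyclesSequence (K : CochainComplex C ℤ) (i j : ℤ) : ShortComplex C :=
  .mk (K.iCycles i) (K.toCycles i j) (by rw [← cancel_mono (K.iCycles j)]; simp)

lemma shortExact_cyclesSequence (hK : K.Acyclic) {i j : ℤ} (hij : i + 1 = j) :
    (cyclesSequence K i j).ShortExact where
  exact := ShortComplex.exact_of_f_is_kernel _ <|
    Limits.isKernelOfComp (K.iCycles j) (K.d i j) (K.cyclesIsKernel i j (by simp [hij])) _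
      (K.toCycles_i i j)
  mono_f := inferInstanceAs (Mono (K.iCycles i))
  epi_g := Preadditive.epi_of_isZero_cokernel' _
    (K.homologyIsCokernel i j (by simp [← hij])) (hK j).isZero_homology

/-- The property `A` holds for the kernel of an epimorphism between objects satisfying it. -/
class IsClosedUnderEpiKernels (A : ObjectProperty C) : Prop where
  prop_X₁_of_shortExact {S : ShortComplex C} (hS : S.ShortExact) (h₂ : A S.X₂) (h₃ : A S.X₃) :
    A S.X₁

lemma prop_cycles [A.ContainsZero] [A.IsClosedUnderIsomorphisms] [IsClosedUnderEpiKernels A]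
    (hK : K.Acyclic) (hb : IsBoundedComplex K) (h : ∀ i, A (K.X i)) (i : ℤ) : A (K.cycles i) := by
  obtain ⟨a, b, hab⟩ := hb
  have zero (i : ℤ) (hi : b < i) : A (K.cycles i) :=
    A.prop_of_isZero (.of_mono (K.iCycles i) (hab i (.inr hi)))
  have pred (i : ℤ) (hi : A (K.cycles (i + 1))) : A (K.cycles i) :=
    IsClosedUnderEpiKernels.prop_X₁_of_shortExact (shortExact_cyclesSequence hK rfl) (h i) hi
  rcases lt_or_ge b i with hi | hi
  · exact zero i hi
  · induction i, hi using Int.leInductionDown with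
    | base => exact pred b (zero _ (lt_add_one b))
    | pred i _ ih => exact pred _ (by rwa [sub_add_cancel])

end Acyclic

section VectorBundleCycles

variable {M : Scheme.{0}} {K : CochainComplex M.Modules ℤ}

instance : (isVectorBundle M).IsClosedUnderIsomorphisms where
  of_iso e h := (isVectorBundle_iff _).mpr (((isVectorBundle_iff _).mp h).of_iso e)

instance : (isVectorBundle M).ContainsZero where
  exists_zero := (Limits.HasZeroObject.zero (C := M.Modules)).imp fun _ hZ =>
    ⟨hZ, (isVectorBundle_iff _).mpr (isLocallyFree_of_isZero hZ)⟩

instance : (isVectorBundle M).IsClosedUnderExtensions where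
  prop_X₂_of_shortExact hS h₁ h₃ := (isVectorBundle_iff _).mpr
    (.extension hS ((isVectorBundle_iff _).mp h₁) ((isVectorBundle_iff _).mp h₃))

instance : IsClosedUnderEpiKernels (isVectorBundle M) where
  prop_X₁_of_shortExact hS h₂ h₃ := (isVectorBundle_iff _).mpr
    (.of_shortExact hS ((isVectorBundle_iff _).mp h₂) ((isVectorBundle_iff _).mp h₃))

lemma exists_splittingOver_cyclesSequence (hK : K.Acyclic) (hb : IsBoundedComplex K)
    (h : ∀ i, isVectorBundle M (K.X i)) (x : M) :
    ∃ U : M.Opens, x ∈ U ∧ ∀ i, Nonempty (SplittingOver (cyclesSequence K i (i + 1)) U) := by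
  have hZ i := (isVectorBundle_iff _).mp (prop_cycles hK hb h i)
  obtain ⟨a, b, hab⟩ := hb
  refine exists_open_forall (Set.finite_Icc (a - 1) b) (fun i U V hVU ⟨σ⟩ => ⟨σ.res hVU⟩) x
    (fun i _ => exists_splittingOver (shortExact_cyclesSequence hK rfl) (hZ _) x) fun i hi => ?_
  have hX : Limits.IsZero (K.X (i + 1)) := hab _ (by rw [Set.mem_Icc] at hi; omega)
  exact ⟨.ofFrame (shortExact_cyclesSequence hK rfl) (e := Fin.elim0)
    (.of_subsingleton fun V _ => Sect.subsingleton_of_isZero (.of_mono (K.iCycles _) hX) V)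
    Fin.elim0 (by simp)⟩

/-- The contraction of a complex over `U` given by splittings of its sequences of cycles. -/
noncomputable def contractionOver {U : M.Opens}
    (σ : ∀ i, SplittingOver (cyclesSequence K i (i + 1)) U) :
    Homotopy (𝟙 (sections K U)) 0 :=
  contraction (K := sections K U) (Z := fun i => ModuleCat.of Γ(M, U) (Sect (K.cycles i).val U))
    (fun i => ModuleCat.ofHom (Sect.map (K.iCycles i).val U))
    (fun i j => ModuleCat.ofHom (Sect.map (K.toCycles i j).val U))
    (fun i => ModuleCat.ofHom ((σ i).r.app U le_rfl))
    (fun i j hij => ModuleCat.ofHom (hij ▸ (σ i).s.app U le_rfl))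
    (fun i j => ModuleCat.hom_ext <| LinearMap.ext fun z =>
      congrArg (fun f : K.X i ⟶ K.X j => Sect.map f.val U z) (K.toCycles_i i j))
    (fun i => ModuleCat.hom_ext <| LinearMap.ext ((σ i).r_f U le_rfl))
    (by rintro i _ rfl; exact ModuleCat.hom_ext <| LinearMap.ext ((σ i).g_s U le_rfl))
    (by rintro i _ rfl; exact ModuleCat.hom_ext <| LinearMap.ext ((σ i).f_r_add_s_g U le_rfl))

end VectorBundleCycles

end SchurComplex

section KGroup

variable {C : Type*} [Category* C] [Abelian C]

namespace IsBoundedComplex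

variable {K L : CochainComplex C ℤ}

lemma finite_support {G : Type*} [Zero G] (hK : IsBoundedComplex K) {f : ℤ → G}
    (hf : ∀ i, Limits.IsZero (K.X i) → f i = 0) : f.support.Finite := by
  obtain ⟨a, b, hab⟩ := hK
  refine (Set.finite_Icc a b).subset fun i hi => ?_
  rw [Set.mem_Icc]
  by_contra h
  exact hi (hf i (hab i (by omega)))

lemma mappingCone (hK : IsBoundedComplex K) (hL : IsBoundedComplex L) (f : K ⟶ L) :
    IsBoundedComplex (CochainComplex.mappingCone f) := by
  obtain ⟨a, b, h⟩ := hK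
  obtain ⟨a', b', h'⟩ := hL
  refine ⟨min (a - 1) a', max b b', fun i hi => ?_⟩
  let σ := CochainComplex.mappingCone.triangleRotateShortComplexSplitting f i
  exact σ.exact.isZero_of_both_isZero (h' i (by omega)) (h (i + 1) (by omega))

end IsBoundedComplex

namespace KGroup

variable {A B : ObjectProperty C} {K L : CochainComplex C ℤ}

lemma mk_eq_add {S : ShortComplex C} (hS : S.ShortExact) (h₁ : A S.X₁) (h₂ : A S.X₂)
    (h₃ : A S.X₃) : mk S.X₂ h₂ = mk S.X₁ h₁ + mk S.X₃ h₃ :=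
  sub_eq_zero.mp <| (QuotientAddGroup.eq_zero_iff _).mpr <|
    AddSubgroup.subset_closure ⟨S, hS, h₁, h₂, h₃, rfl⟩

lemma mk_eq_zero {X : C} (hX : A X) (h : Limits.IsZero X) : mk X hX = 0 := by
  have hS : (ShortComplex.mk (0 : X ⟶ X) (0 : X ⟶ X) (by simp)).ShortExact :=
    { exact := ShortComplex.exact_of_isZero_X₂ _ h
      mono_f := ⟨fun _ _ _ => h.eq_of_tgt _ _⟩
      epi_g := ⟨fun _ _ _ => h.eq_of_src _ _⟩ }
  simpa using mk_eq_add hS hX hX hX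

lemma mk_eq_of_iso [A.ContainsZero] {X Y : C} (hX : A X) (hY : A Y) (e : X ≅ Y) :
    mk X hX = mk Y hY := by
  obtain ⟨Z, h, hZ⟩ := A.exists_prop_of_containsZero
  have hS : (ShortComplex.mk e.hom (0 : Y ⟶ Z) (by simp)).ShortExact :=
    { exact := (ShortComplex.exact_iff_epi _ rfl).mpr (inferInstanceAs (Epi e.hom))
      mono_f := inferInstanceAs (Mono e.hom)
      epi_g := ⟨fun _ _ _ => h.eq_of_src _ _⟩ }
  simpa [mk_eq_zero hZ h] using (mk_eq_add hS hX hY hZ).symm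

/-- The homomorphism of Grothendieck groups induced by an inclusion of subcategories. -/
noncomputable def map (hAB : A ≤ B) : KGroup A →+ KGroup B :=
  QuotientAddGroup.lift _ (FreeAbelianGroup.lift fun X => mk X.obj (hAB _ X.property)) <| by
    rw [AddSubgroup.closure_le]
    rintro _ ⟨S, hS, h₁, h₂, h₃, rfl⟩
    simpa [sub_eq_zero] using mk_eq_add hS (hAB _ h₁) (hAB _ h₂) (hAB _ h₃)

lemma map_mk (hAB : A ≤ B) (X : C) (hX : A X) : map hAB (mk X hX) = mk X (hAB _ hX) :=
  FreeAbelianGroup.lift_apply_of _ _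

lemma finite_support_mk (hb : IsBoundedComplex K) (hK : ∀ i, A (K.X i)) :
    (Function.support fun i => mk (K.X i) (hK i)).Finite :=
  hb.finite_support fun _ => mk_eq_zero _

lemma map_ofComplex (hAB : A ≤ B) (hb : IsBoundedComplex K) (hK : ∀ i, A (K.X i)) :
    map hAB (ofComplex K hK) = ofComplex K fun i => hAB _ (hK i) := by
  have hfin : (Function.support fun i : ℤ => (i.negOnePow : ℤ) • mk (K.X i) (hK i)).Finite :=
    (finite_support_mk hb hK).subset (Function.support_smul_subset_right _ _)
  simp only [ofComplex, AddMonoidHom.map_finsum _ hfin, map_zsmul, map_mk]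

lemma ofComplex_congr [A.ContainsZero] (hK : ∀ i, A (K.X i)) (hL : ∀ i, A (L.X i))
    (e : ∀ i, K.X i ≅ L.X i) : ofComplex K hK = ofComplex L hL :=
  finsum_congr fun i => by rw [mk_eq_of_iso (hK i) (hL i) (e i)]

lemma finsum_negOnePow_smul_add_succ {G : Type*} [AddCommGroup G] {f g : ℤ → G}
    (hf : f.support.Finite) (hg : g.support.Finite) :
    ∑ᶠ i : ℤ, (i.negOnePow : ℤ) • (f i + g (i + 1)) =
      ∑ᶠ i : ℤ, (i.negOnePow : ℤ) • f i - ∑ᶠ i : ℤ, (i.negOnePow : ℤ) • g i := by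
  have h (i : ℤ) : (i.negOnePow : ℤ) • (f i + g (i + 1)) =
      (i.negOnePow : ℤ) • f i - ((i + 1).negOnePow : ℤ) • g (i + 1) := by
    simp only [smul_add, Int.negOnePow_succ, Units.val_neg, neg_smul, sub_neg_eq_add]
  have hfin {k : ℤ → G} (hk : k.support.Finite) :
      (Function.support fun i : ℤ => (i.negOnePow : ℤ) • k i).Finite :=
    hk.subset (Function.support_smul_subset_right (fun i : ℤ => (i.negOnePow : ℤ)) k)
  rw [finsum_congr h,
    finsum_sub_distrib (hfin hf) ((hfin hg).preimage (add_left_injective 1).injOn)]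
  exact congrArg _
    (finsum_comp_equiv (f := fun i : ℤ => (i.negOnePow : ℤ) • g i) (Equiv.addRight (1 : ℤ)))

lemma ofComplex_eq_zero_of_acyclic [A.ContainsZero] [A.IsClosedUnderIsomorphisms]
    [SchurComplex.IsClosedUnderEpiKernels A] (hK : K.Acyclic) (hb : IsBoundedComplex K)
    (h : ∀ i, A (K.X i)) : ofComplex K h = 0 := by
  have hZ := SchurComplex.prop_cycles hK hb h
  have hfin : (Function.support fun i => mk (K.cycles i) (hZ i)).Finite :=
    hb.finite_support fun i hi => mk_eq_zero _ (.of_mono (K.iCycles i) hi)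
  have hmk (i : ℤ) : mk (K.X i) (h i) = mk (K.cycles i) (hZ i) + mk (K.cycles (i + 1)) (hZ _) :=
    mk_eq_add (SchurComplex.shortExact_cyclesSequence hK rfl) _ _ _
  simp only [ofComplex, hmk]
  rw [finsum_negOnePow_smul_add_succ hfin hfin, sub_self]

end KGroup

section QuasiIso

variable {A : ObjectProperty C} {K L : CochainComplex C ℤ}

lemma acyclic_mappingCone (f : K ⟶ L) [QuasiIso f] :
    (CochainComplex.mappingCone f).Acyclic := by
  have h := (HomotopyCategory.subcategoryAcyclic C).trW_iff_of_distinguished _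
    (HomotopyCategory.mappingCone_triangleh_distinguished f)
  rw [← HomotopyCategory.quasiIso_eq_trW_subcategoryAcyclic] at h
  rw [← HomotopyCategory.quotient_obj_mem_subcategoryAcyclic_iff_acyclic]
  exact h.mp ((HomotopyCategory.quotient_map_mem_quasiIso_iff _).mpr ‹_›)

lemma prop_mappingCone [A.IsClosedUnderExtensions] (f : K ⟶ L) (hK : ∀ i, A (K.X i))
    (hL : ∀ i, A (L.X i)) (i : ℤ) : A ((CochainComplex.mappingCone f).X i) :=
  A.prop_X₂_of_shortExact
    (CochainComplex.mappingCone.triangleRotateShortComplexSplitting f i).shortExact (hL i)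
    (hK (i + 1))

lemma KGroup.ofComplex_eq_of_quasiIso [A.ContainsZero] [A.IsClosedUnderIsomorphisms]
    [A.IsClosedUnderExtensions] [SchurComplex.IsClosedUnderEpiKernels A] (f : K ⟶ L) [QuasiIso f]
    (hbK : IsBoundedComplex K) (hbL : IsBoundedComplex L) (hK : ∀ i, A (K.X i))
    (hL : ∀ i, A (L.X i)) : ofComplex K hK = ofComplex L hL := by
  have hQ := prop_mappingCone f hK hL
  have hmk (i : ℤ) : mk _ (hQ i) = mk (L.X i) (hL i) + mk (K.X (i + 1)) (hK (i + 1)) :=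
    mk_eq_add
      (CochainComplex.mappingCone.triangleRotateShortComplexSplitting f i).shortExact _ _ _
  have h0 := ofComplex_eq_zero_of_acyclic (acyclic_mappingCone f) (hbK.mappingCone hbL f) hQ
  simp only [ofComplex, hmk] at h0
  rw [finsum_negOnePow_smul_add_succ (finite_support_mk hbL hL) (finite_support_mk hbK hK),
    sub_eq_zero] at h0
  exact h0.symm

end QuasiIso

end KGroup

namespace SchurComplex

section Functoriality

variable {M : Scheme.{0}} [M.Over (Spec (CommRingCat.of ℂ))]
  {n : ℕ} {V : Type} [AddCommGroup V] [Module ℂ V]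
  (ρ : Representation ℂ (Equiv.Perm (Fin n)) V) {P Q T : CochainComplex M.Modules ℤ}

/-- The map on sections of the terms of complexes, between the modules in `sections`. -/
noncomputable def sectionsTermMap (r : ∀ a, P.X a ⟶ Q.X a) (U : M.Opens) (a : ℤ) :
    (sections P U).X a →ₗ[Γ(M, U)] (sections Q U).X a :=
  Sect.map (r a).val U

lemma sectionsRes_sectionsTermMap (r : ∀ a, P.X a ⟶ Q.X a) {U W : M.Opens} (i : W ⟶ U) (a : ℤ)
    (x : (sections P U).X a) :
    sectionsRes Q i a (sectionsTermMap r U a x) = sectionsTermMap r W a (sectionsRes P i a x) :=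
  (Sect.map_res (r a).val (leOfHom i) x).symm

lemma schurMap_res_sectionsTermMap (r : ∀ a, P.X a ⟶ Q.X a) {U W : M.Opens} (i : W ⟶ U) (j : ℤ)
    (x : schurTerm ρ (sections P U) j) :
    schurMap ρ j (AlgHom.id ℂ Γ(M, W)) (sectionsTermMap r W)
        (schurMap ρ j (resAlgHom i) (sectionsRes P i) x) =
      schurMap ρ j (resAlgHom i) (sectionsRes Q i)
        (schurMap ρ j (AlgHom.id ℂ Γ(M, U)) (sectionsTermMap r U) x) := by
  have : RingHomCompTriple (resAlgHom i : Γ(M, U) →+* Γ(M, W)) (RingHom.id _)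
      (resAlgHom i : Γ(M, U) →+* Γ(M, W)) := ⟨rfl⟩
  let t (a : ℤ) := (sectionsTermMap r W a).comp (sectionsRes P i a)
  rw [← schurMap_comp ρ j (resAlgHom i) (AlgHom.id ℂ _) (resAlgHom i) rfl (sectionsRes P i)
      (sectionsTermMap r W) t (fun _ _ => rfl) x]
  exact schurMap_comp ρ j (AlgHom.id ℂ _) (resAlgHom i) (resAlgHom i) rfl (sectionsTermMap r U)
    (sectionsRes Q i) t (fun a x => (sectionsRes_sectionsTermMap r i a x).symm) x

/-- The morphism of presheaves `(V ⊗ P^{⊗ n})^{S_n} → (V ⊗ Q^{⊗ n})^{S_n}` in degree `j` induced by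
morphisms of the terms of `P` and `Q`, which need not commute with the differentials. -/
noncomputable def presheafTermMap (r : ∀ a, P.X a ⟶ Q.X a) (j : ℤ) :
    presheafTerm ρ P j ⟶ presheafTerm ρ Q j :=
  PresheafOfModules.homMk
    { app := fun U => AddCommGrpCat.ofHom
        (schurMap ρ j (AlgHom.id ℂ Γ(M, U.unop)) (sectionsTermMap r U.unop)).toAddMonoidHom
      naturality := fun _ _ i => AddCommGrpCat.hom_ext <| AddMonoidHom.ext <|
        schurMap_res_sectionsTermMap ρ r i.unop j }
    fun U c x => (schurMap ρ j (AlgHom.id ℂ _) (sectionsTermMap r U.unop)).map_smulₛₗ c x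

lemma presheafTermMap_id (j : ℤ) : presheafTermMap ρ (fun a => 𝟙 (P.X a)) j = 𝟙 _ := by
  ext U x
  exact schurMap_id ρ j _ rfl (sectionsTermMap (fun a => 𝟙 (P.X a)) U.unop) (fun _ _ => rfl) x

lemma presheafTermMap_comp (r : ∀ a, P.X a ⟶ Q.X a) (s : ∀ a, Q.X a ⟶ T.X a) (j : ℤ) :
    presheafTermMap ρ (fun a => r a ≫ s a) j = presheafTermMap ρ r j ≫ presheafTermMap ρ s j := by
  ext U x
  exact schurMap_comp ρ j (AlgHom.id ℂ _) (AlgHom.id ℂ _) (AlgHom.id ℂ _) rfl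
    (sectionsTermMap r U.unop) (sectionsTermMap s U.unop)
    (sectionsTermMap (fun a => r a ≫ s a) U.unop) (fun _ _ => rfl) x

/-- The isomorphism of presheaves `(V ⊗ P^{⊗ n})^{S_n} ≅ (V ⊗ Q^{⊗ n})^{S_n}` in degree `j` induced
by isomorphisms of the terms of `P` and `Q`, which need not commute with the differentials. -/
noncomputable def presheafTermIso (e : ∀ a, P.X a ≅ Q.X a) (j : ℤ) :
    presheafTerm ρ P j ≅ presheafTerm ρ Q j where
  hom := presheafTermMap ρ (fun a => (e a).hom) j
  inv := presheafTermMap ρ (fun a => (e a).inv) j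
  hom_inv_id := by
    rw [← presheafTermMap_comp]
    simp only [Iso.hom_inv_id, presheafTermMap_id]
  inv_hom_id := by
    rw [← presheafTermMap_comp]
    simp only [Iso.inv_hom_id, presheafTermMap_id]

/-- The sheafification of `presheafTermIso`. -/
noncomputable def invariantComplexXIso (e : ∀ a, P.X a ≅ Q.X a) (j : ℤ) :
    (invariantComplex ρ P).X j ≅ (invariantComplex ρ Q).X j :=
  (sheafify M).mapIso (presheafTermIso ρ e j)

/-- The morphism `P(U) → Q(U)` of complexes of sections over `U`. -/
noncomputable def sectionsMap (f : P ⟶ Q) (U : M.Opens) : sections P U ⟶ sections Q U where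
  f a := ModuleCat.ofHom (sectionsTermMap f.f U a)
  comm' a b _ := ModuleCat.hom_ext <| LinearMap.ext fun x =>
    congrArg (fun g : P.X a ⟶ Q.X b => Sect.map g.val U x) (f.comm a b)

lemma presheafComplex_d (P : CochainComplex M.Modules ℤ) (j : ℤ) :
    (presheafComplex ρ P).d j (j + 1) = presheafDiff ρ P j :=
  CochainComplex.of_d _ _ _

/-- The morphism of complexes of presheaves `(V ⊗ P^{⊗ n})^{S_n} → (V ⊗ Q^{⊗ n})^{S_n}` induced by
a morphism of complexes. -/
noncomputable def presheafMap (f : P ⟶ Q) : presheafComplex ρ P ⟶ presheafComplex ρ Q :=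
  CochainComplex.ofHom (presheafTermMap ρ f.f) fun j => by
    rw [presheafComplex_d, presheafComplex_d]
    ext U x
    exact (schurTermMap_schurDiff ρ (sectionsMap f U.unop) x).symm

instance : (sheafify M).Additive :=
  have : Limits.PreservesBinaryBiproducts (sheafify M) :=
    Limits.preservesBinaryBiproducts_of_preservesBinaryCoproducts _
  Functor.additive_of_preservesBinaryBiproducts _

/-- The morphism of complexes of sheaves `(V ⊗ P^{⊗ n})^{S_n} → (V ⊗ Q^{⊗ n})^{S_n}` induced by
a morphism of complexes. -/
noncomputable def invariantMap (f : P ⟶ Q) : invariantComplex ρ P ⟶ invariantComplex ρ Q :=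
  ((sheafify M).mapHomologicalComplex _).map (presheafMap ρ f)

lemma invariantMap_id : invariantMap ρ (𝟙 P) = 𝟙 _ := by
  have h : presheafMap ρ (𝟙 P) = 𝟙 _ := HomologicalComplex.hom_ext _ _ (presheafTermMap_id ρ)
  rw [invariantMap, h, CategoryTheory.Functor.map_id]
  rfl

lemma invariantMap_comp (f : P ⟶ Q) (g : Q ⟶ T) :
    invariantMap ρ (f ≫ g) = invariantMap ρ f ≫ invariantMap ρ g := by
  have h : presheafMap ρ (f ≫ g) = presheafMap ρ f ≫ presheafMap ρ g :=
    HomologicalComplex.hom_ext _ _ (presheafTermMap_comp ρ f.f g.f)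
  rw [invariantMap, h, Functor.map_comp]
  rfl

end Functoriality

section LocalHomology

variable {M : Scheme.{0}}

namespace Sect

lemma hom_ext {E F : M.Modules} {f g : E ⟶ F} (h : ∀ V x, map f.val V x = map g.val V x) :
    f = g := by
  refine Scheme.Modules.hom_ext _ _ fun V => ?_
  ext x
  exact h V x

lemma map_sheafify_toSheafify {F G : M.PresheafOfModules} (f : F ⟶ G) {V : M.Opens}
    (x : Sect F V) :
    map ((sheafify M).map f).val V (map (toSheafify F) V x) =
      map (toSheafify G) V (map f V x) :=
  congrArg (fun t => map t V x)
    ((PresheafOfModules.sheafificationAdjunction (𝟙 M.ringCatSheaf.obj)).unit.naturality f).symm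

end Sect

lemma homologyMap_eq_of_locally {K L : CochainComplex M.Modules ℤ} {f g : K ⟶ L} {j : ℤ}
    (h : ∀ V (z : Sect (K.X (j + 1)).val V), Sect.map (K.d (j + 1) (j + 1 + 1)).val V z = 0 →
      ∀ p ∈ V, ∃ (W : M.Opens) (hW : W ≤ V), p ∈ W ∧ ∃ y,
        Sect.map (L.d j (j + 1)).val W y + Sect.map (g.f (j + 1)).val W (Sect.res hW z) =
          Sect.map (f.f (j + 1)).val W (Sect.res hW z)) :
    HomologicalComplex.homologyMap f (j + 1) = HomologicalComplex.homologyMap g (j + 1) := by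
  have map_comp {E F G : M.Modules} (f : E ⟶ F) (g : F ⟶ G) {W : M.Opens} (x : Sect E.val W) :
      Sect.map g.val W (Sect.map f.val W x) = Sect.map (f ≫ g).val W x := rfl
  rw [← cancel_epi (K.homologyπ (j + 1)), HomologicalComplex.homologyπ_naturality,
    HomologicalComplex.homologyπ_naturality]
  refine Sect.hom_ext fun V z => Sect.eq_of_locally_eq fun p hp => ?_
  obtain ⟨W, hW, hpW, y, hy⟩ := h V (Sect.map (K.iCycles (j + 1)).val V z)
    (congrArg (fun t : K.cycles (j + 1) ⟶ _ => Sect.map t.val V z) (K.iCycles_d _ _)) p hp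
  have hcycles : Sect.map (L.toCycles j (j + 1)).val W y +
      Sect.map (HomologicalComplex.cyclesMap g (j + 1)).val W (Sect.res hW z) =
        Sect.map (HomologicalComplex.cyclesMap f (j + 1)).val W (Sect.res hW z) := by
    refine Sect.map_injective_of_mono (L.iCycles (j + 1)) W ?_
    rw [map_add, map_comp, map_comp, map_comp, L.toCycles_i, HomologicalComplex.cyclesMap_i,
      HomologicalComplex.cyclesMap_i, ← map_comp, ← map_comp, Sect.map_res, hy]
  refine ⟨W, hW, hpW, ?_⟩
  rw [← Sect.map_res, ← Sect.map_res, ← map_comp, ← map_comp, ← hcycles, map_add, map_comp,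
    L.toCycles_comp_homologyπ]
  exact zero_add _

lemma homologyMap_sheafify_eq_of_locally {K L : CochainComplex M.PresheafOfModules ℤ}
    {f g : K ⟶ L} {j : ℤ}
    (h : ∀ V (x : Sect (K.X (j + 1)) V), Sect.map (K.d (j + 1) (j + 1 + 1)) V x = 0 →
      ∀ p ∈ V, ∃ (W : M.Opens) (hW : W ≤ V), p ∈ W ∧ ∃ y,
        Sect.map (L.d j (j + 1)) W y + Sect.map (g.f (j + 1)) W (Sect.res hW x) =
          Sect.map (f.f (j + 1)) W (Sect.res hW x)) :
    HomologicalComplex.homologyMap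
        (((sheafify M).mapHomologicalComplex _).map f) (j + 1) =
      HomologicalComplex.homologyMap
        (((sheafify M).mapHomologicalComplex _).map g) (j + 1) := by
  refine homologyMap_eq_of_locally fun V z hz p hp => ?_
  obtain ⟨W₁, hW₁, hp₁, x, hx⟩ := Sect.exists_map_eq_res (toSheafify _) z hp
  have hdx : Sect.map (toSheafify _) W₁ (Sect.map (K.d (j + 1) (j + 1 + 1)) W₁ x) = 0 := by
    rw [← Sect.map_sheafify_toSheafify, hx]
    exact (Sect.map_res _ hW₁ z).trans ((congrArg _ hz).trans (map_zero _))
  obtain ⟨W₂, hW₂, hp₂, hdx'⟩ := Sect.exists_res_eq_zero _ hdx hp₁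
  obtain ⟨W₃, hW₃, hp₃, y, hy⟩ := h W₂ (Sect.res hW₂ x) (by rw [Sect.map_res, hdx']) p hp₂
  have hz' : Sect.res (hW₃.trans (hW₂.trans hW₁)) z =
      Sect.map (toSheafify _) W₃ (Sect.res hW₃ (Sect.res hW₂ x)) := by
    rw [Sect.map_res, Sect.map_res, hx, Sect.res_res]
    exact (Sect.res_res hW₁ _ z).symm
  refine ⟨W₃, hW₃.trans (hW₂.trans hW₁), hp₃, Sect.map (toSheafify _) W₃ y, ?_⟩
  rw [hz']
  exact (congrArg₂ (· + ·) (Sect.map_sheafify_toSheafify _ _)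
    (Sect.map_sheafify_toSheafify _ _)).trans <| (map_add _ _ _).symm.trans <|
    (congrArg _ hy).trans (Sect.map_sheafify_toSheafify _ _).symm

end LocalHomology

section LocalHomotopy

variable {M : Scheme.{0}} {P Q P' Q' : CochainComplex M.Modules ℤ} {f g : P ⟶ Q}

/-- The morphisms induced by `f` and `g` on sections over small open subsets are homotopic. The
homotopies need not be compatible with restriction. -/
def LocallyHomotopic (f g : P ⟶ Q) : Prop :=
  ∀ x : M, ∃ U : M.Opens, x ∈ U ∧
    ∀ W ≤ U, Nonempty (Homotopy (sectionsMap f W) (sectionsMap g W))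

namespace LocallyHomotopic

lemma comp (h : LocallyHomotopic f g) (u : P' ⟶ P) (v : Q ⟶ Q') :
    LocallyHomotopic (u ≫ f ≫ v) (u ≫ g ≫ v) := fun x =>
  have ⟨U, hx, hU⟩ := h x
  ⟨U, hx, fun W hW =>
    ⟨((hU W hW).some.compRight (sectionsMap v W)).compLeft (sectionsMap u W)⟩⟩

lemma add_left (h : LocallyHomotopic f g) (u : P ⟶ Q) : LocallyHomotopic (u + f) (u + g) :=
  fun x =>
  have ⟨U, hx, hU⟩ := h x
  ⟨U, hx, fun W hW => ⟨(Homotopy.refl (sectionsMap u W)).add (hU W hW).some⟩⟩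

lemma id_zero (hP : P.Acyclic) (hb : IsBoundedComplex P) (h : ∀ i, isVectorBundle M (P.X i)) :
    LocallyHomotopic (𝟙 P) 0 := fun x =>
  have ⟨U, hx, hU⟩ := exists_splittingOver_cyclesSequence hP hb h x
  ⟨U, hx, fun _ hW => ⟨contractionOver fun i => (hU i).some.res hW⟩⟩

lemma id_fst_inl (hQ : Q.Acyclic) (hb : IsBoundedComplex Q)
    (h : ∀ i, isVectorBundle M (Q.X i)) :
    LocallyHomotopic (𝟙 (P ⊞ Q)) (Limits.biprod.fst ≫ Limits.biprod.inl) := by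
  simpa using ((id_zero hQ hb h).comp Limits.biprod.snd Limits.biprod.inr).add_left
    (Limits.biprod.fst ≫ Limits.biprod.inl : P ⊞ Q ⟶ P ⊞ Q)

end LocallyHomotopic

variable [M.Over (Spec (CommRingCat.of ℂ))] {n : ℕ} {V : Type} [AddCommGroup V] [Module ℂ V]
  (ρ : Representation ℂ (Equiv.Perm (Fin n)) V)

lemma LocallyHomotopic.exists_map_presheafDiff_add (h : LocallyHomotopic f g) {j : ℤ} {V : M.Opens}
    (x : Sect (presheafTerm ρ P (j + 1)) V) (hx : Sect.map (presheafDiff ρ P (j + 1)) V x = 0)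
    (p : M) (hp : p ∈ V) :
    ∃ (W : M.Opens) (hW : W ≤ V), p ∈ W ∧ ∃ y,
      Sect.map (presheafDiff ρ Q j) W y +
          Sect.map (presheafTermMap ρ g.f (j + 1)) W (Sect.res hW x) =
        Sect.map (presheafTermMap ρ f.f (j + 1)) W (Sect.res hW x) := by
  obtain ⟨U, hpU, hU⟩ := h p
  obtain ⟨H⟩ := hU (V ⊓ U) inf_le_right
  refine ⟨V ⊓ U, inf_le_left, ⟨hp, hpU⟩, schurHomotopy ρ j H (Sect.res inf_le_left x), ?_⟩
  have hdx : schurDiff ρ (sections P (V ⊓ U)) (j + 1) (Sect.res inf_le_left x) = 0 :=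
    (Sect.map_res (presheafDiff ρ P (j + 1)) inf_le_left x).trans
      ((congrArg _ hx).trans (map_zero _))
  exact schurDiff_schurHomotopy_add_of_schurDiff_eq_zero ρ H hdx

lemma LocallyHomotopic.homologyMap_invariantMap_eq (h : LocallyHomotopic f g) (j : ℤ) :
    HomologicalComplex.homologyMap (invariantMap ρ f) j =
      HomologicalComplex.homologyMap (invariantMap ρ g) j := by
  obtain ⟨j, rfl⟩ : ∃ i, j = i + 1 := ⟨j - 1, by ring⟩
  refine homologyMap_sheafify_eq_of_locally ?_
  rw [presheafComplex_d, presheafComplex_d]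
  exact fun V => h.exists_map_presheafDiff_add ρ

lemma quasiIso_invariantMap_biprod_inl (hQ : Q.Acyclic) (hb : IsBoundedComplex Q)
    (h : ∀ i, isVectorBundle M (Q.X i)) :
    QuasiIso (invariantMap ρ (Limits.biprod.inl : P ⟶ P ⊞ Q)) := by
  refine (quasiIso_iff _).mpr fun j => (quasiIsoAt_iff_isIso_homologyMap _ _).mpr
    ⟨HomologicalComplex.homologyMap (invariantMap ρ Limits.biprod.fst) j, ?_, ?_⟩
  · rw [← HomologicalComplex.homologyMap_comp, ← invariantMap_comp, Limits.biprod.inl_fst,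
      invariantMap_id, HomologicalComplex.homologyMap_id]
  · rw [← HomologicalComplex.homologyMap_comp, ← invariantMap_comp,
      ← (LocallyHomotopic.id_fst_inl hQ hb h).homologyMap_invariantMap_eq, invariantMap_id,
      HomologicalComplex.homologyMap_id]

end LocalHomotopy

end SchurComplex

section Biproduct

variable {C : Type*} [Category* C] [Abelian C] {K L : CochainComplex C ℤ}

lemma IsBoundedComplex.biprod (hK : IsBoundedComplex K) (hL : IsBoundedComplex L) :
    IsBoundedComplex (K ⊞ L) := by
  obtain ⟨a, b, h⟩ := hK
  obtain ⟨a', b', h'⟩ := hL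
  refine ⟨min a a', max b b', fun i hi => .of_iso ?_ (HomologicalComplex.biprodXIso K L i)⟩
  exact (Limits.biprod_isZero_iff _ _).mpr ⟨h _ (by omega), h' _ (by omega)⟩

lemma prop_biprod_X {A : ObjectProperty C} [A.IsClosedUnderIsomorphisms]
    [A.IsClosedUnderExtensions] (hK : ∀ i, A (K.X i)) (hL : ∀ i, A (L.X i)) (i : ℤ) :
    A ((K ⊞ L).X i) :=
  A.prop_of_iso (HomologicalComplex.biprodXIso K L i).symm (A.prop_biprod (hK i) (hL i))

/-- Reversal of the order of the three summands of a direct sum. -/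
noncomputable def biprodReverseIso (X Y Z : C) : X ⊞ (Y ⊞ Z) ≅ Z ⊞ (Y ⊞ X) :=
  Limits.biprod.braiding _ _ ≪≫
    Limits.biprod.mapIso (Limits.biprod.braiding _ _) (Iso.refl _) ≪≫ Limits.biprod.associator _ _ _

/-- The decomposition of the terms of a mapping cone. -/
noncomputable def mappingConeXIso (f : K ⟶ L) (i : ℤ) :
    (CochainComplex.mappingCone f).X i ≅ K.X (i + 1) ⊞ L.X i :=
  HomologicalComplex.homotopyCofiber.XIsoBiprod f i (i + 1) rfl

/-- The terms of `K ⊞ cone s` and of `L ⊞ cone (𝟙 K)` are isomorphic for `s : K ⟶ L`, even though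
the differentials differ. -/
noncomputable def biprodMappingConeXIso (s : K ⟶ L) (i : ℤ) :
    (K ⊞ CochainComplex.mappingCone s).X i ≅ (L ⊞ CochainComplex.mappingCone (𝟙 K)).X i :=
  HomologicalComplex.biprodXIso _ _ i ≪≫
    Limits.biprod.mapIso (Iso.refl _) (mappingConeXIso s i) ≪≫ biprodReverseIso _ _ _ ≪≫
    Limits.biprod.mapIso (Iso.refl _) (mappingConeXIso (𝟙 K) i).symm ≪≫
    (HomologicalComplex.biprodXIso _ _ i).symm

end Biproduct

namespace SchurComplex

lemma subsingleton_tensorPower {R : Type} [CommRing R] {K : CochainComplex (ModuleCat.{0} R) ℤ}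
    {n : ℕ} {j c : ℤ} (hK : ∀ a, c < |a| → Subsingleton (K.X a)) (hj : n * c < |j|) :
    Subsingleton (TensorPower K n j) := by
  have h : (LinearMap.id : TensorPower K n j →ₗ[R] TensorPower K n j) = 0 := by
    refine linearMap_ext fun y hy => ?_
    obtain ⟨k, hk⟩ : ∃ k, c < |(y k).1| := by
      by_contra! hc
      refine hj.not_ge ?_
      calc |j| = |∑ k, (y k).1| := by rw [hy]
        _ ≤ ∑ k, |(y k).1| := Finset.abs_sum_le_sum_abs _ _
        _ ≤ ∑ _ : Fin n, c := Finset.sum_le_sum fun k _ => hc k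
        _ = n * c := by simp
    have := hK _ hk
    exact homog_eq_zero hy k (a := (y k).1) (Sigma.ext rfl (heq_of_eq (Subsingleton.elim _ _)))
  exact subsingleton_of_forall_eq 0 fun x => LinearMap.congr_fun h x

section InvariantComplex

variable {M : Scheme.{0}} [M.Over (Spec (CommRingCat.of ℂ))] {n : ℕ} {V : Type} [AddCommGroup V]
  [Module ℂ V] (ρ : Representation ℂ (Equiv.Perm (Fin n)) V) {P Q C : CochainComplex M.Modules ℤ}

lemma isZero_presheafTerm {c j : ℤ} (hP : ∀ a, c < |a| → Limits.IsZero (P.X a))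
    (hj : n * c < |j|) : Limits.IsZero (presheafTerm ρ P j) := by
  rw [Limits.IsZero.iff_id_eq_zero]
  ext U x
  have hT := subsingleton_tensorPower (n := n) (K := sections P U.unop)
    (fun a ha => Sect.subsingleton_of_isZero (hP a ha) U.unop) hj
  have : Subsingleton (TwistedPower V (sections P U.unop) n j) :=
    inferInstanceAs (Subsingleton (_ ⊗[Γ(M, U.unop)] TensorPower (sections P U.unop) n j))
  exact Subsingleton.elim (α := schurTerm ρ (sections P U.unop) j) _ _

lemma isBoundedComplex_invariantComplex (hP : IsBoundedComplex P) :
    IsBoundedComplex (invariantComplex ρ P) := by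
  obtain ⟨a, b, hab⟩ := hP
  let c := max |a| |b|
  have hc (i : ℤ) (hi : c < |i|) : Limits.IsZero (P.X i) := by
    refine hab i ?_
    by_contra! h
    exact hi.not_ge (abs_le_max_abs_abs h.1 h.2)
  refine ⟨-(n * c), n * c, fun j hj => (sheafify M).map_isZero (isZero_presheafTerm ρ hc ?_)⟩
  rw [lt_abs]
  omega

variable [Module.Finite ℂ V]

lemma isVectorBundle_invariantComplex (hb : IsBoundedComplex P)
    (hP : ∀ i, isVectorBundle M (P.X i)) (j : ℤ) :
    isVectorBundle M ((invariantComplex ρ P).X j) :=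
  (isVectorBundle_iff _).mpr <| IsLocallyFree.sheafify <|
    isLocallyFree_presheafTerm P ρ j hb fun a => (isVectorBundle_iff _).mp (hP a)

lemma ofComplex_invariantComplex_biprod (hbP : IsBoundedComplex P)
    (hP : ∀ i, isVectorBundle M (P.X i)) (hbC : IsBoundedComplex C)
    (hC : ∀ i, isVectorBundle M (C.X i)) (hC' : C.Acyclic) :
    KGroup.ofComplex _ (isVectorBundle_invariantComplex ρ hbP hP) =
      KGroup.ofComplex _
        (isVectorBundle_invariantComplex ρ (hbP.biprod hbC) (prop_biprod_X hP hC)) :=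
  have := quasiIso_invariantMap_biprod_inl ρ (P := P) hC' hbC hC
  KGroup.ofComplex_eq_of_quasiIso (invariantMap ρ Limits.biprod.inl)
    (isBoundedComplex_invariantComplex ρ hbP)
    (isBoundedComplex_invariantComplex ρ (hbP.biprod hbC)) _ _

lemma ofComplex_invariantComplex_eq_of_quasiIso (hbP : IsBoundedComplex P)
    (hP : ∀ i, isVectorBundle M (P.X i)) (hbQ : IsBoundedComplex Q)
    (hQ : ∀ i, isVectorBundle M (Q.X i)) (s : P ⟶ Q) [QuasiIso s] :
    KGroup.ofComplex _ (isVectorBundle_invariantComplex ρ hbP hP) =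
      KGroup.ofComplex _ (isVectorBundle_invariantComplex ρ hbQ hQ) := by
  rw [ofComplex_invariantComplex_biprod ρ hbP hP (hbP.mappingCone hbQ s)
      (prop_mappingCone s hP hQ) (acyclic_mappingCone s),
    ofComplex_invariantComplex_biprod ρ hbQ hQ (hbP.mappingCone hbP (𝟙 P))
      (prop_mappingCone (𝟙 P) hP hP) (acyclic_mappingCone (𝟙 P))]
  exact KGroup.ofComplex_congr _ _ (invariantComplexXIso ρ (biprodMappingConeXIso s))

end InvariantComplex

instance finite_specht (μ : YoungDiagram) : Module.Finite ℂ (Specht μ) := by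
  have : Module.Finite ℂ (MonoidAlgebra ℂ (Equiv.Perm (Fin μ.card))) := by
    infer_instance
  exact Module.Finite.of_injective
    ((Ideal.span {youngSymmetrizer μ}).subtype.restrictScalars ℂ) Subtype.val_injective

end SchurComplex

theorem lemma3p6_general (M : Scheme.{0}) [M.Over (Spec (CommRingCat.of ℂ))]
    (P Q : CochainComplex M.Modules ℤ)
    (hP : IsBoundedComplex P) (hP' : ∀ i, isVectorBundle M (P.X i))
    (hQ : IsBoundedComplex Q) (hQ' : ∀ i, isVectorBundle M (Q.X i))
    (s : P ⟶ Q) (hs : QuasiIso s) {n : ℕ} {V : Type} [AddCommGroup V] [Module ℂ V]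
    [Module.Finite ℂ V] (ρ : Representation ℂ (Equiv.Perm (Fin n)) V) :
    (IsBoundedComplex (SchurComplex.invariantComplex ρ P) ∧
      IsBoundedComplex (SchurComplex.invariantComplex ρ Q)) ∧
    (∃ (h₁ : ∀ i, isVectorBundle M ((SchurComplex.invariantComplex ρ P).X i))
        (h₂ : ∀ i, isVectorBundle M ((SchurComplex.invariantComplex ρ Q).X i)),
      KGroup.ofComplex _ h₁ = KGroup.ofComplex _ h₂) ∧
    ∃ (h₁ : ∀ i, isCoherent M ((SchurComplex.invariantComplex ρ P).X i))
        (h₂ : ∀ i, isCoherent M ((SchurComplex.invariantComplex ρ Q).X i)),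
      KGroup.ofComplex _ h₁ = KGroup.ofComplex _ h₂ := by
  have hbP := SchurComplex.isBoundedComplex_invariantComplex ρ hP
  have hbQ := SchurComplex.isBoundedComplex_invariantComplex ρ hQ
  have h := SchurComplex.ofComplex_invariantComplex_eq_of_quasiIso ρ hP hP' hQ hQ' s
  have hle : isVectorBundle M ≤ isCoherent M := fun _ hE => hE.isCoherent
  have h' := congrArg (KGroup.map hle) h
  rw [KGroup.map_ofComplex hle hbP, KGroup.map_ofComplex hle hbQ] at h'
  exact ⟨⟨hbP, hbQ⟩, ⟨_, _, h⟩, ⟨_, _, h'⟩⟩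

theorem lemma3p6 (M : Scheme.{0}) [M.Over (Spec (CommRingCat.of ℂ))]
    (P Q : CochainComplex M.Modules ℤ)
    (hP : IsBoundedComplex P) (hP' : ∀ i, isVectorBundle M (P.X i))
    (hQ : IsBoundedComplex Q) (hQ' : ∀ i, isVectorBundle M (Q.X i))
    (s : P ⟶ Q) (hs : QuasiIso s) (μ : YoungDiagram) :
    (IsBoundedComplex (SchurComplex.schurComplex μ P) ∧
      IsBoundedComplex (SchurComplex.schurComplex μ Q)) ∧
    (∃ (h₁ : ∀ i, isVectorBundle M ((SchurComplex.schurComplex μ P).X i))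
        (h₂ : ∀ i, isVectorBundle M ((SchurComplex.schurComplex μ Q).X i)),
      KGroup.ofComplex _ h₁ = KGroup.ofComplex _ h₂) ∧
    (IsLocallyNoetherian M →
      ∃ (h₁ : ∀ i, isCoherent M ((SchurComplex.schurComplex μ P).X i))
        (h₂ : ∀ i, isCoherent M ((SchurComplex.schurComplex μ Q).X i)),
      KGroup.ofComplex _ h₁ = KGroup.ofComplex _ h₂) := by
  obtain ⟨hb, hv, hc⟩ := lemma3p6_general M P Q hP hP' hQ hQ' s hs (SchurComplex.spechtRep μ)
  exact ⟨hb, hv, fun _ => hc⟩
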